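/- **Setting.** Let $n\ge 2$. A continuous (resp. smooth) spacetime is a smooth manifold of dimension $n+1$ with a continuous (resp. smooth) Lorentzian metric of signature $(-,+,\dots,+)$ and a time orientation. In a continuous spacetime, a *future directed timelike curve* is a Lipschitz curve $\gamma\colon[a,b]\to M$, $a<b$, whose velocity is future directed timelike almost everywhere and satisfies $g(\gamma',\gamma')<-\varepsilon$ almost everywhere for some $\varepsilon>0$; a *future directed causal curve* is a Lipschitz curve whose velocity is future directed causal almost everywhere. $I^+(p,U)$ is the set of endpoints of future directed timelike curves in $U$ starting at $p$, and $J^+(p,U)$ is $\{p\}$ together with the endpoints of future directed causal curves in $U$ starting at $p$. A continuous spacetime $(M_{\rm ext},g_{\rm ext})$ is a *continuous extension* of a smooth spacetime $(M,g)$ of the same dimension if $(M,g)$ embeds isometrically, preserving time orientations, onto a proper (open) subset of it, with which $M$ is identified. Let $\partial M=\overline M\setminus M$, and let $\partial^-M$ be the set of $p\in\partial M$ for which there is a future directed timelike curve $\gamma\colon[a,b]\to M_{\rm ext}$ with $\gamma(a)=p$ and $\gamma((a,b])\subset M$. A function on $M$ *extends continuously* to $M\cup\{\mathcal O\}$ if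 it is the restriction of a continuous function on $M\cup\{\mathcal O\}$ (with the subspace topology from $M_{\rm ext}$); a tensor on $M$ extends continuously if its components in some coordinate neighborhood of $\mathcal O$ do. Extensions are denoted by a tilde. **Corollary.** Let $(M_{\rm ext},g_{\rm ext})$ be a continuous extension of a smooth spacetime $(M,g)$ such that $M=I^+(\mathcal O,M_{\rm ext})$ for some $\mathcal O\in\partial^-M$. Assume: (a) $(M,g)$ solves the Einstein equations with a perfect fluid $(u,\rho,p)$: $u$ is a smooth future directed timelike vector field on $M$ with $g(u,u)=-1$, $\rho$ and $p$ are smooth functions on $M$, and $\mathrm{Ric}-\tfrac12Rg=8\pi\big[(\rho+p)\,u_*\otimes u_*+p\,g\big]$ on $M$, where $u_*=g(u,\cdot)$. (b) All integral curves of $u$ have past endpoint $\mathcal O$ in $M_{\rm ext}$, and the curves extended by this endpoint are future directed timelike curves on every compact domain; that is, every integral curve of $u$ on an interval $(c,d)$ continues to the past to an integral curve $\gamma$ in $M$ on an interval $(a,d)$, $-\infty<a\le c$, with $\gamma(\tau)\to\mathcal O$ as $\tau\to a$, and, with $\gamma(a)=\mathcal O$, $\gamma|_{[a,b]}$ is a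 future directed timelike curve in $M_{\rm ext}$ for all $b\in(a,d)$. (c) The Ricci tensor $\mathrm{Ric}$ of $(M,g)$, $\rho$ and $p$ extend continuously to $M\cup\{\mathcal O\}$. Assume moreover that at least one of the following holds: (d) $(M_{\rm ext},g_{\rm ext})$ is strongly causal at $\mathcal O$: every neighborhood $U$ of $\mathcal O$ contains a neighborhood $V$ of $\mathcal O$ such that every future directed causal curve in $M_{\rm ext}$ with both endpoints in $V$ lies in $U$; (d$'$) every neighborhood $U$ of $\mathcal O$ contains a neighborhood $V$ of $\mathcal O$ with $\partial^-M\cap V\subset J^+(\mathcal O,V)$. Then the continuous extension of $\mathrm{Ric}$ to $M\cup\{\mathcal O\}$ satisfies $$\widetilde{\mathrm{Ric}}(\mathcal O)=\frac{16\pi\,\widetilde\rho(\mathcal O)}{n-1}\,g_{\rm ext}(\mathcal O).$$ -/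

import Mathlib

open Set Filter Topology MeasureTheory
open scoped Manifold ContDiff

noncomputable section

namespace Cosmo

/-- The model space `ℝ^{n+1}`, with coordinates `x⁰, …, xⁿ`. -/
abbrev Coord (n : ℕ) : Type := EuclideanSpace ℝ (Fin (n + 1))

/-- The tangent space at a point of an `(n+1)`-dimensional manifold. -/
abbrev Tan (n : ℕ) {M : Type*} [TopologicalSpace M] [ChartedSpace (Coord n) M] (x : M) : Type :=
  TangentSpace 𝓘(ℝ, Coord n) x

/-- A covariant 2-tensor field: a bilinear form on each tangent space. -/
abbrev Tensor2 (n : ℕ) (M : Type*) [TopologicalSpace M] [ChartedSpace (Coord n) M] : Type _ :=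
  (x : M) → Tan n x →L[ℝ] Tan n x →L[ℝ] ℝ

/-- A (not necessarily continuous) vector field. -/
abbrev VField (n : ℕ) (M : Type*) [TopologicalSpace M] [ChartedSpace (Coord n) M] : Type _ :=
  (x : M) → Tan n x

section Coordinates

variable {n : ℕ} {M : Type*} [TopologicalSpace M] [ChartedSpace (Coord n) M]

/-- The smooth charts of `M`: all members of the maximal smooth atlas. -/
def smoothCharts (n : ℕ) (M : Type*) [TopologicalSpace M] [ChartedSpace (Coord n) M] :
    Set (OpenPartialHomeomorph M (Coord n)) :=
  IsManifold.maximalAtlas 𝓘(ℝ, Coord n) ∞ M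

/-- The coordinate one-form `dxⁱ` of the chart `φ` at `x`. -/
def dcoord (φ : OpenPartialHomeomorph M (Coord n)) (x : M) (i : Fin (n + 1)) : Tan n x →L[ℝ] ℝ :=
  (EuclideanSpace.proj i : Coord n →L[ℝ] ℝ).comp
    (mfderiv 𝓘(ℝ, Coord n) 𝓘(ℝ, Coord n) φ x : Tan n x →L[ℝ] Coord n)

/-- The coordinate vector `∂ᵢ` of the chart `φ` at `x`. -/
def partialVec (φ : OpenPartialHomeomorph M (Coord n)) (x : M) (i : Fin (n + 1)) : Tan n x :=
  (mfderiv 𝓘(ℝ, Coord n) 𝓘(ℝ, Coord n) φ x : Tan n x →L[ℝ] Coord n).inverse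
    (EuclideanSpace.single i (1 : ℝ))

/-- The component `T(∂ᵢ, ∂ⱼ)` of a 2-tensor in the chart `φ`, as a function on `M`
(meaningful on `φ.source`). -/
def comp2 (T : Tensor2 n M) (φ : OpenPartialHomeomorph M (Coord n)) (i j : Fin (n + 1)) (x : M) :
    ℝ :=
  T x (partialVec φ x i) (partialVec φ x j)

/-- The matrix `g_{ij}` of `g` in the chart `φ`, as a function of the coordinates. -/
def coordMatrix (g : Tensor2 n M) (φ : OpenPartialHomeomorph M (Coord n)) (y : Coord n) :
    Matrix (Fin (n + 1)) (Fin (n + 1)) ℝ :=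
  Matrix.of fun i j => comp2 g φ i j (φ.symm y)

end Coordinates

section Curvature

variable {n : ℕ}

/-- The partial derivative `∂f/∂xⁱ` at `y`. -/
def pd (i : Fin (n + 1)) (f : Coord n → ℝ) (y : Coord n) : ℝ :=
  fderiv ℝ f y (EuclideanSpace.single i (1 : ℝ))

/-- The Christoffel symbol
`Γᵏᵢⱼ = ½ gᵏˡ (∂ᵢ g_{jl} + ∂ⱼ g_{il} - ∂ₗ g_{ij})`. -/
def christoffel (G : Coord n → Matrix (Fin (n + 1)) (Fin (n + 1)) ℝ) (k i j : Fin (n + 1))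
    (y : Coord n) : ℝ :=
  (1 / 2) * ∑ l, (G y)⁻¹ k l *
    (pd i (fun z => G z j l) y + pd j (fun z => G z i l) y - pd l (fun z => G z i j) y)

/-- The Ricci component
`R_{ij} = ∂ₖ Γᵏᵢⱼ - ∂ᵢ Γᵏₖⱼ + Γᵏₖₗ Γˡᵢⱼ - Γᵏᵢₗ Γˡₖⱼ` (positive on round spheres). -/
def ricciCoord (G : Coord n → Matrix (Fin (n + 1)) (Fin (n + 1)) ℝ) (i j : Fin (n + 1))
    (y : Coord n) : ℝ :=
  ∑ k, (pd k (christoffel G k i j) y - pd i (christoffel G k k j) y)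
    + ∑ k, ∑ l, (christoffel G k k l y * christoffel G l i j y
        - christoffel G k i l y * christoffel G l k j y)

variable {M : Type*} [TopologicalSpace M] [ChartedSpace (Coord n) M]

/-- The Ricci tensor `Ric = R_{ij} dxⁱ ⊗ dxʲ`, computed at `x` in the preferred chart at `x`
(it does not depend on the chart wherever `g` is smooth). -/
def ricci (g : Tensor2 n M) : Tensor2 n M := fun x =>
  ∑ i, ∑ j, ricciCoord (coordMatrix g (chartAt (Coord n) x)) i j (chartAt (Coord n) x x) •
    (dcoord (chartAt (Coord n) x) x i).smulRight (dcoord (chartAt (Coord n) x) x j)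

/-- The scalar curvature `R = gⁱʲ R_{ij}`. -/
def scalarCurv (g : Tensor2 n M) (x : M) : ℝ :=
  ∑ i, ∑ j, (coordMatrix g (chartAt (Coord n) x) (chartAt (Coord n) x x))⁻¹ i j *
    ricciCoord (coordMatrix g (chartAt (Coord n) x)) i j (chartAt (Coord n) x x)

end Curvature

/-- A continuous spacetime of dimension `n + 1` on the manifold `M`: a continuous Lorentzian metric
of signature `(-, +, …, +)` together with a time orientation, given by a continuous timelike
vector field. -/
structure ContinuousSpacetime (n : ℕ) (M : Type*) [TopologicalSpace M]
    [ChartedSpace (Coord n) M] [IsManifold 𝓘(ℝ, Coord n) ∞ M] where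
  /-- the metric -/
  g : Tensor2 n M
  symm : ∀ (x : M) (v w : Tan n x), g x v w = g x w v
  lorentzian : ∀ x : M, ∃ b : Module.Basis (Fin (n + 1)) ℝ (Tan n x),
    ∀ i j, g x (b i) (b j) = if i = j then (if i = 0 then -1 else 1) else 0
  continuous_metric : ∀ φ ∈ smoothCharts n M, ∀ i j, ContinuousOn (comp2 g φ i j) φ.source
  /-- the vector field that defines the time orientation -/
  X : VField n M
  continuous_X : Continuous fun x => (⟨x, X x⟩ : TangentBundle 𝓘(ℝ, Coord n) M)
  timelike_X : ∀ x, g x (X x) (X x) < 0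

namespace ContinuousSpacetime

variable {n : ℕ} {M : Type*} [TopologicalSpace M] [ChartedSpace (Coord n) M]
  [IsManifold 𝓘(ℝ, Coord n) ∞ M]

/-- The metric is smooth on the set `N`: its components in all coordinates are. -/
def SmoothMetricOn (S : ContinuousSpacetime n M) (N : Set M) : Prop :=
  ∀ φ ∈ smoothCharts n M, ∀ i j,
    ContMDiffOn 𝓘(ℝ, Coord n) 𝓘(ℝ, ℝ) ∞ (comp2 S.g φ i j) (φ.source ∩ N)

/-- `v` is a future directed timelike vector. -/
def FutureTimelike (S : ContinuousSpacetime n M) {x : M} (v : Tan n x) : Prop :=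
  S.g x v v < 0 ∧ S.g x (S.X x) v < 0

/-- `v` is a future directed causal (timelike or null, nonzero) vector. -/
def FutureCausal (S : ContinuousSpacetime n M) {x : M} (v : Tan n x) : Prop :=
  v ≠ 0 ∧ S.g x v v ≤ 0 ∧ S.g x (S.X x) v < 0

end ContinuousSpacetime

section Curves

variable {n : ℕ} {M : Type*} [TopologicalSpace M] [ChartedSpace (Coord n) M]
  [IsManifold 𝓘(ℝ, Coord n) ∞ M]

/-- The velocity `γ'(t)` (equal to `0` where `γ` is not differentiable). -/
def velocity (n : ℕ) {M : Type*} [TopologicalSpace M] [ChartedSpace (Coord n) M] (γ : ℝ → M)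
    (t : ℝ) : Tan n (γ t) :=
  (mfderiv 𝓘(ℝ, ℝ) 𝓘(ℝ, Coord n) γ t : ℝ →L[ℝ] Tan n (γ t)) 1

/-- `γ : [a, b] → M` is a Lipschitz curve. As `[a, b]` is compact, being Lipschitz for the distance
of a Riemannian metric is the same as being continuous and locally Lipschitz in charts. -/
def LipschitzCurve (n : ℕ) {M : Type*} [TopologicalSpace M] [ChartedSpace (Coord n) M] (γ : ℝ → M)
    (a b : ℝ) : Prop :=
  ContinuousOn γ (Icc a b) ∧ ∀ t ∈ Icc a b, ∃ φ ∈ smoothCharts n M, γ t ∈ φ.source ∧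
    ∃ s ∈ 𝓝[Icc a b] t, ∃ K : NNReal, LipschitzOnWith K (φ ∘ γ) s

namespace ContinuousSpacetime

variable (S : ContinuousSpacetime n M)

/-- `γ : [a, b] → M` is a future directed timelike curve: it is Lipschitz, its velocity is future
directed timelike almost everywhere, and `g(γ', γ') < -ε` almost everywhere for some `ε > 0`. -/
def IsTimelikeCurve (γ : ℝ → M) (a b : ℝ) : Prop :=
  a < b ∧ LipschitzCurve n γ a b ∧ ∃ ε > 0, ∀ᵐ t ∂(volume.restrict (Icc a b)),
    S.FutureTimelike (velocity n γ t) ∧ S.g (γ t) (velocity n γ t) (velocity n γ t) < -ε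

/-- `γ : [a, b] → M` is a future directed causal curve. -/
def IsCausalCurve (γ : ℝ → M) (a b : ℝ) : Prop :=
  a < b ∧ LipschitzCurve n γ a b ∧ ∀ᵐ t ∂(volume.restrict (Icc a b)),
    S.FutureCausal (velocity n γ t)

/-- The timelike future `I⁺(p, U)`. -/
def timelikeFuture (p : M) (U : Set M) : Set M :=
  {q | ∃ (γ : ℝ → M) (a b : ℝ), S.IsTimelikeCurve γ a b ∧ MapsTo γ (Icc a b) U ∧
    γ a = p ∧ γ b = q}

/-- The causal future `J⁺(p, U)`; it contains `p`. -/
def causalFuture (p : M) (U : Set M) : Set M :=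
  {q | (q = p ∧ p ∈ U) ∨ ∃ (γ : ℝ → M) (a b : ℝ), S.IsCausalCurve γ a b ∧
    MapsTo γ (Icc a b) U ∧ γ a = p ∧ γ b = q}

/-- The past boundary `∂⁻N`: the points of `closure N \ N` from which a future directed timelike
curve enters `N` at once and stays in it. -/
def pastBoundary (N : Set M) : Set M :=
  {p | p ∈ closure N \ N ∧ ∃ (γ : ℝ → M) (a b : ℝ), S.IsTimelikeCurve γ a b ∧ γ a = p ∧
    ∀ t ∈ Ioc a b, γ t ∈ N}

/-- Strong causality at the point `o`. -/
def StronglyCausalAt (o : M) : Prop :=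
  ∀ U ∈ 𝓝 o, ∃ V ∈ 𝓝 o, V ⊆ U ∧ ∀ (γ : ℝ → M) (a b : ℝ), S.IsCausalCurve γ a b →
    γ a ∈ V → γ b ∈ V → MapsTo γ (Icc a b) U

/-- Near `o`, the past boundary of `N` lies in the local causal future of `o`. -/
def PastBoundaryLocallyInFuture (N : Set M) (o : M) : Prop :=
  ∀ U ∈ 𝓝 o, ∃ V ∈ 𝓝 o, V ⊆ U ∧ S.pastBoundary N ∩ V ⊆ S.causalFuture o V

/-- `(M, g)` is a continuous extension of the smooth spacetime `(N, g|_N)`: here `N` is identified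
with its image, which is open because the dimensions agree, and it carries the restricted metric
and time orientation. -/
structure IsContinuousExtensionOf (N : Set M) : Prop where
  isOpen : IsOpen N
  proper : N ≠ univ
  smooth : S.SmoothMetricOn N

/-- `(N, g|_N)` solves the Einstein equations with the perfect fluid `(u, ρ, p)`. Only the values
of `u`, `ρ`, `p` on `N` matter. -/
structure SolvesEinsteinPerfectFluid (N : Set M) (u : VField n M) (ρ p : M → ℝ) : Prop where
  smooth_u : ContMDiffOn 𝓘(ℝ, Coord n) 𝓘(ℝ, Coord n).tangent ∞
    (fun x => (⟨x, u x⟩ : TangentBundle 𝓘(ℝ, Coord n) M)) N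
  smooth_ρ : ContMDiffOn 𝓘(ℝ, Coord n) 𝓘(ℝ, ℝ) ∞ ρ N
  smooth_p : ContMDiffOn 𝓘(ℝ, Coord n) 𝓘(ℝ, ℝ) ∞ p N
  future_u : ∀ x ∈ N, S.FutureTimelike (u x)
  unit_u : ∀ x ∈ N, S.g x (u x) (u x) = -1
  einstein : ∀ x ∈ N, ∀ v w : Tan n x,
    ricci S.g x v w - (1 / 2) * scalarCurv S.g x * S.g x v w
      = 8 * Real.pi * ((ρ x + p x) * (S.g x (u x) v * S.g x (u x) w) + p x * S.g x v w)

/-- All integral curves of `u` in `N` have past endpoint `o`, and the curves extended by `o` are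
future directed timelike on compact domains: every integral curve on an interval `(c, d)` continues
to the past, as an integral curve in `N`, to an interval `(a, d)` at whose left end it converges
to `o`, and with the value `o` at `a` it is a future directed timelike curve on `[a, b]` for all
`b` in `(a, d)`. -/
def IntegralCurvesEmanateFrom (N : Set M) (u : VField n M) (o : M) : Prop :=
  ∀ (γ : ℝ → M) (c d : ℝ), c < d → MapsTo γ (Ioo c d) N →
    IsMIntegralCurveOn (I := 𝓘(ℝ, Coord n)) γ u (Ioo c d) →
    ∃ (Γ : ℝ → M) (a : ℝ), a ≤ c ∧ EqOn Γ γ (Ioo c d) ∧ MapsTo Γ (Ioo a d) N ∧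
      IsMIntegralCurveOn (I := 𝓘(ℝ, Coord n)) Γ u (Ioo a d) ∧
      Γ a = o ∧ Tendsto Γ (𝓝[>] a) (𝓝 o) ∧
      ∀ b ∈ Ioo a d, S.IsTimelikeCurve Γ a b

end ContinuousSpacetime

end Curves

section Extensions

variable {n : ℕ} {M : Type*} [TopologicalSpace M] [ChartedSpace (Coord n) M]

/-- `f'` is a continuous extension of the function `f` on `N` to `N ∪ {o}`. Only the values of
`f'` on `N ∪ {o}` matter. -/
def IsContExtFun (N : Set M) (o : M) (f f' : M → ℝ) : Prop :=
  EqOn f' f N ∧ ContinuousOn f' (insert o N)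

/-- `T'` is a continuous extension of the 2-tensor field `T` on `N` to `N ∪ {o}`: in some
coordinate neighborhood of `o` its components are continuous on `N ∪ {o}`. -/
def IsContExtTensor (N : Set M) (o : M) (T T' : Tensor2 n M) : Prop :=
  (∀ x ∈ N, T' x = T x) ∧ ∃ φ ∈ smoothCharts n M, o ∈ φ.source ∧
    ∀ i j, ContinuousOn (comp2 T' φ i j) (φ.source ∩ insert o N)

end Extensions

end Cosmo

end

/-!
Trace reversal turns the Einstein equations into
`Ric - 8π (ρ - p) / (n - 1) g = 8π (ρ + p) u_* ⊗ u_*`, so the right-hand side extends continuously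
to `o`. If `ρ + p` had a nonzero limit there, then `u_* ⊗ u_*`, hence also `u`, would have a limit
`w` at `o`, and near `o` all flow lines of `u` would be almost straight in direction `w` in a chart.
A point of `M = I⁺(o)` close to `o` but slightly off the line through `o` in direction `w` lies on a
flow line emanating from `o`; followed to the past, this almost straight line misses `o` and reaches
a point of `M` in the past of `o`. A straight segment in the chart then joins this point to `o`, so
`o ∈ I⁺(o) = M`, a contradiction. Hence `ρ + p` tends to `0` at `o`. Along a flow line emanating
from `o` the velocity `u` is bounded, so the right-hand side tends to `0` there.
-/

noncomputable section

namespace Cosmo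

section Analysis

variable {E : Type*} [NormedAddCommGroup E] [NormedSpace ℝ E]

lemma exists_mapsTo_Icc_right {X : Type*} [TopologicalSpace X] {γ : ℝ → X} {a b : ℝ} {K : Set X}
    (hγ : ContinuousOn γ (Icc a b)) (hK : IsClosed K) (hab : a ≤ b) (hb : γ b ∈ K) :
    ∃ t ∈ Icc a b, MapsTo γ (Icc t b) K ∧ (t = a ∨ γ t ∉ interior K) := by
  set A := {t ∈ Icc a b | γ t ∈ (interior K)ᶜ}
  have hinside {t : ℝ} (ht : t ∈ Icc a b) (htA : t ∉ A) : γ t ∈ K := by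
    by_contra hout
    exact htA ⟨ht, fun hint => hout (interior_subset hint)⟩
  rcases A.eq_empty_or_nonempty with hA | hA
  · exact ⟨a, left_mem_Icc.2 hab, fun t ht => hinside ht (hA ▸ notMem_empty t), Or.inl rfl⟩
  have hAclosed : IsClosed A :=
    hγ.preimage_isClosed_of_isClosed isClosed_Icc isOpen_interior.isClosed_compl
  have hAbdd : BddAbove A := bddAbove_Icc.mono (sep_subset _ _)
  have hlast := hAclosed.csSup_mem hA hAbdd
  refine ⟨sSup A, hlast.1, ?_, Or.inr hlast.2⟩
  rcases hlast.1.2.eq_or_lt with heq | hlt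
  · rwa [heq, Icc_self, mapsTo_singleton]
  have hafter : MapsTo γ (Ioc (sSup A) b) K := fun t ht =>
    hinside ⟨hlast.1.1.trans ht.1.le, ht.2⟩ (notMem_of_csSup_lt ht.1 hAbdd)
  have hclosure := hafter.closure_of_continuousOn (t := K)
    (hγ.mono ((closure_Ioc hlt.ne).subset.trans (Icc_subset_Icc_left hlast.1.1)))
  rwa [closure_Ioc hlt.ne, hK.closure_eq] at hclosure

lemma eventually_forall_mem_closedBall_symm {X Y : Type*} [TopologicalSpace X]
    [PseudoMetricSpace Y] {φ : OpenPartialHomeomorph X Y} {x : X} (hx : x ∈ φ.source)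
    {P : X → Prop} (hP : ∀ᶠ x' in 𝓝 x, P x') :
    ∀ᶠ r in 𝓝[>] (0 : ℝ), ∀ y ∈ Metric.closedBall (φ x) r, y ∈ φ.target ∧ P (φ.symm y) := by
  obtain ⟨δ, hδ, hball⟩ := Metric.eventually_nhds_iff_ball.1
    ((φ.open_target.eventually_mem (φ.map_source hx)).and ((φ.tendsto_symm hx).eventually hP))
  filter_upwards [Ioo_mem_nhdsGT hδ] with r hr y hy
  exact hball y (Metric.closedBall_subset_ball hr.2 hy)

lemma norm_sub_sub_smul_le_of_hasDerivAt {f f' : ℝ → E} {w : E} {a b η : ℝ} (hab : a ≤ b)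
    (hf : ContinuousOn f (Icc a b)) (hf' : ∀ t ∈ Ioo a b, HasDerivAt f (f' t) t)
    (hη : ∀ t ∈ Ioo a b, ‖f' t - w‖ ≤ η) : ‖f b - f a - (b - a) • w‖ ≤ η * (b - a) := by
  rcases hab.eq_or_lt with rfl | hlt
  · simp
  have hη0 : 0 ≤ η :=
    (norm_nonneg _).trans (hη ((a + b) / 2) ⟨by linarith, by linarith⟩)
  have hlip : LipschitzOnWith η.toNNReal (fun t => f t - t • w) (Ioo a b) := by
    refine (convex_Ioo a b).lipschitzOnWith_of_nnnorm_hasDerivWithin_le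
      (f' := fun t => f' t - w) (fun t ht => ?_) fun t ht => ?_
    · have hd := (hf' t ht).fun_sub ((hasDerivAt_id t).smul_const w)
      rw [one_smul] at hd
      exact hd.hasDerivWithinAt
    · exact (Real.le_toNNReal_iff_coe_le hη0).2 (hη t ht)
  have hclosed : LipschitzOnWith η.toNNReal (fun t => f t - t • w) (Icc a b) := by
    rw [← closure_Ioo hlt.ne]
    refine (lipschitzOnWith_closure_iff ?_).2 hlip
    rw [closure_Ioo hlt.ne]
    fun_prop
  have hdist := hclosed.dist_le_mul b (right_mem_Icc.2 hab) a (left_mem_Icc.2 hab)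
  rw [dist_eq_norm, Real.dist_eq, abs_of_nonneg (sub_nonneg.2 hab),
    Real.coe_toNNReal η hη0] at hdist
  rwa [show f b - f a - (b - a) • w = f b - b • w - (f a - a • w) by module]

lemma exists_norm_sub_lt_notMem_span_singleton {w : E} (hw : w ≠ 0)
    (hspan : Submodule.span ℝ {w} ≠ ⊤) {η : ℝ} (hη : 0 < η) :
    ∃ v : E, ‖v - w‖ < η ∧ w ∉ Submodule.span ℝ {v} := by
  obtain ⟨v, hvη, hv⟩ : ∃ v ∈ Metric.ball w η, v ∉ Submodule.span ℝ {w} := by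
    by_contra! hball
    exact hspan (Submodule.eq_top_of_nonempty_interior' _
      ⟨w, interior_maximal hball Metric.isOpen_ball (Metric.mem_ball_self hη)⟩)
  refine ⟨v, mem_ball_iff_norm.1 hvη, fun hwv => ?_⟩
  obtain ⟨k, rfl⟩ := Submodule.mem_span_singleton.1 hwv
  have hk : k ≠ 0 := left_ne_zero_of_smul hw
  exact hv (Submodule.mem_span_singleton.2 ⟨k⁻¹, inv_smul_smul₀ hk v⟩)

lemma span_singleton_ne_top (hE : 1 < Module.finrank ℝ E) (w : E) :
    Submodule.span ℝ {w} ≠ ⊤ := fun htop =>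
  hE.not_ge <| finrank_le_one w fun _ =>
    Submodule.mem_span_singleton.1 (htop ▸ Submodule.mem_top)

lemma exists_pos_mul_le_norm_smul_sub_smul {v w : E} (h : w ∉ Submodule.span ℝ {v}) :
    ∃ c > 0, ∀ τ s : ℝ, 0 < s → c * s ≤ ‖τ • v - s • w‖ := by
  refine ⟨Metric.infDist w (Submodule.span ℝ {v}),
    ((Submodule.closed_of_finiteDimensional _).notMem_iff_infDist_pos
      (Submodule.nonempty _)).1 h, fun τ s hs => ?_⟩
  have hmem : (s⁻¹ * τ) • v ∈ Submodule.span ℝ {v} :=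
    Submodule.smul_mem _ _ (Submodule.mem_span_singleton_self v)
  calc Metric.infDist w (Submodule.span ℝ {v}) * s ≤ ‖w - (s⁻¹ * τ) • v‖ * s := by
        gcongr
        exact (Metric.infDist_le_dist_of_mem hmem).trans_eq (dist_eq_norm _ _)
    _ = ‖τ • v - s • w‖ := by
        rw [norm_sub_rev, ← abs_of_pos hs, ← Real.norm_eq_abs, mul_comm, ← norm_smul,
          Real.norm_eq_abs, abs_of_pos hs, smul_sub, smul_smul, mul_inv_cancel_left₀ hs.ne']

lemma exists_pos_norm_smul_mul_lt (v : E) (C : ℝ) {δ : ℝ} (hδ : 0 < δ) :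
    ∃ τ > 0, ‖(τ : ℝ) • v‖ * C < δ := by
  have hcont : Continuous fun τ : ℝ => ‖τ • v‖ * C := by fun_prop
  have hzero : Tendsto (fun τ : ℝ => ‖τ • v‖ * C) (𝓝[>] 0) (𝓝 0) :=
    (hcont.tendsto' 0 0 (by rw [zero_smul, norm_zero, zero_mul])).mono_left nhdsWithin_le_nhds
  exact ((eventually_mem_nhdsWithin (s := Ioi (0 : ℝ))).and (hzero.eventually_lt_const hδ)).exists

-- A curve through `y` whose velocity stays within `η` of `w` reaches `z` after time `s`. If `z` is
-- close to `0` compared with `y`, then `0` lies almost in direction `w` from `y`.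
lemma norm_inv_smul_neg_sub_lt {y z w : E} {r s η : ℝ} (hη : 0 < η) (hs : 0 ≤ s) (hy : r ≤ ‖y‖)
    (hdrift : ‖z - y - s • w‖ ≤ η * s) (hz : ‖z‖ * (‖w‖ + 2 * η) < η * r) :
    0 < s ∧ ‖s⁻¹ • (-y) - w‖ < 2 * η := by
  have hr : r ≤ ‖z‖ + (‖w‖ + η) * s :=
    calc r ≤ ‖z - (z - y - s • w) - s • w‖ := hy.trans_eq (by congr 1; abel)
      _ ≤ ‖z‖ + ‖z - y - s • w‖ + ‖s • w‖ :=
        (norm_sub_le _ _).trans (add_le_add_left (norm_sub_le _ _) _)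
      _ ≤ ‖z‖ + (‖w‖ + η) * s := by
        rw [norm_smul, Real.norm_of_nonneg hs]
        linarith
  have hzs : ‖z‖ < η * s := by
    refine lt_of_mul_lt_mul_right ?_ (show 0 ≤ ‖w‖ + η by positivity)
    nlinarith
  have hs0 : 0 < s := pos_of_mul_pos_right ((norm_nonneg z).trans_lt hzs) hη.le
  refine ⟨hs0, lt_of_mul_lt_mul_left ?_ hs⟩
  calc s * ‖s⁻¹ • (-y) - w‖ = ‖(z - y - s • w) - z‖ := by
        rw [← Real.norm_of_nonneg hs, ← norm_smul, Real.norm_of_nonneg hs, smul_sub,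
          smul_inv_smul₀ hs0.ne']
        congr 1
        abel
    _ ≤ ‖z - y - s • w‖ + ‖z‖ := norm_sub_le _ _
    _ < s * (2 * η) := by linarith

lemma exists_tendsto_of_tendsto_mul {ι X : Type*} [Fintype ι] {l : Filter X} [l.NeBot]
    {f ξ : ι → X → ℝ} {A : ι → ι → ℝ} {ξ₀ : ι → ℝ} {c : ℝ}
    (hf : ∀ i j, Tendsto (fun x => f i x * f j x) l (𝓝 (A i j)))
    (hξ : ∀ i, Tendsto (ξ i) l (𝓝 (ξ₀ i))) (hc : 0 < c)
    (hle : ∀ᶠ x in l, ∑ i, ξ i x * f i x ≤ -c) (i : ι) : ∃ y, Tendsto (f i) l (𝓝 y) := by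
  -- The products fix `f` only up to sign; `s` has a sign, so `s ^ 2 → L` gives `s → -√L`, and
  -- `f i = f i * s / s`.
  set s : X → ℝ := fun x => ∑ i, ξ i x * f i x with hs
  have hfs (i : ι) : Tendsto (fun x => f i x * s x) l (𝓝 (∑ j, ξ₀ j * A i j)) :=
    (tendsto_finsetSum _ fun j _ => (hξ j).mul (hf i j)).congr fun x => by
      rw [hs, Finset.mul_sum]
      exact Finset.sum_congr rfl fun j _ => by ring
  obtain ⟨L, hL⟩ : ∃ L, Tendsto (fun x => s x ^ 2) l (𝓝 L) :=
    ⟨_, (tendsto_finsetSum _ fun i _ => (hξ i).mul (hfs i)).congr fun x => by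
      rw [sq, hs, Finset.sum_mul]
      exact Finset.sum_congr rfl fun i _ => by ring⟩
  have hLpos : 0 < L := by
    refine (sq_pos_of_pos hc).trans_le (ge_of_tendsto hL ?_)
    filter_upwards [hle] with x hx
    exact sq_le_sq' (by linarith) (by linarith) |>.trans_eq (neg_sq _)
  have hslim : Tendsto s l (𝓝 (-√L)) := by
    refine hL.sqrt.neg.congr' ?_
    filter_upwards [hle] with x hx
    rw [Real.sqrt_sq_eq_abs, abs_of_neg (by linarith), neg_neg]
  refine ⟨_, ((hfs i).div hslim (neg_ne_zero.2 (Real.sqrt_pos.2 hLpos).ne')).congr' ?_⟩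
  filter_upwards [hle] with x hx
  exact mul_div_cancel_right₀ _ (by linarith)

lemma lipschitzOnWith_congr {X Y : Type*} [PseudoEMetricSpace X] [PseudoEMetricSpace Y]
    {f g : X → Y} {s : Set X} {K : NNReal} (hf : LipschitzOnWith K f s) (h : EqOn g f s) :
    LipschitzOnWith K g s := fun x hx y hy => by
  simpa only [h hx, h hy] using hf hx hy

lemma lipschitzOnWith_union_of_le_of_ge {X : Type*} [PseudoMetricSpace X] {f : ℝ → X} {s t : Set ℝ}
    {b : ℝ} {K : NNReal} (hf : LipschitzOnWith K f s) (hg : LipschitzOnWith K f t) (hbs : b ∈ s)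
    (hbt : b ∈ t) (hs : ∀ x ∈ s, x ≤ b) (ht : ∀ x ∈ t, b ≤ x) : LipschitzOnWith K f (s ∪ t) := by
  have hcross {x y : ℝ} (hx : x ∈ s) (hy : y ∈ t) : dist (f x) (f y) ≤ K * dist x y :=
    calc dist (f x) (f y) ≤ dist (f x) (f b) + dist (f b) (f y) := dist_triangle _ _ _
      _ ≤ K * dist x b + K * dist b y :=
        add_le_add (hf.dist_le_mul x hx b hbs) (hg.dist_le_mul b hbt y hy)
      _ = K * dist x y := by
        rw [dist_comm x b, dist_comm b y, dist_comm x y, Real.dist_eq, Real.dist_eq, Real.dist_eq,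
          abs_of_nonneg (sub_nonneg.2 (hs x hx)), abs_of_nonneg (sub_nonneg.2 (ht y hy)),
          abs_of_nonneg (sub_nonneg.2 ((hs x hx).trans (ht y hy)))]
        ring
  refine LipschitzOnWith.of_dist_le_mul fun x hx y hy => ?_
  rcases hx with hx | hx <;> rcases hy with hy | hy
  · exact hf.dist_le_mul x hx y hy
  · exact hcross hx hy
  · rw [dist_comm (f x), dist_comm x]
    exact hcross hy hx
  · exact hg.dist_le_mul x hx y hy

end Analysis

section Charts

variable {n : ℕ} {M : Type*} [TopologicalSpace M] [ChartedSpace (Coord n) M]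
  {φ : OpenPartialHomeomorph M (Coord n)} {x : M}

/-- The components of a tangent vector in the chart `φ`, gathered in one coordinate vector. -/
def toCoord (φ : OpenPartialHomeomorph M (Coord n)) (x : M) : Tan n x →L[ℝ] Coord n :=
  mfderiv 𝓘(ℝ, Coord n) 𝓘(ℝ, Coord n) φ x

/-- The tangent vector with prescribed components in the chart `φ` (meaningful on `φ.source`). -/
def ofCoord (φ : OpenPartialHomeomorph M (Coord n)) (x : M) : Coord n →L[ℝ] Tan n x :=
  (toCoord φ x).inverse

lemma mdifferentiable_of_mem_smoothCharts (hφ : φ ∈ smoothCharts n M) :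
    φ.MDifferentiable 𝓘(ℝ, Coord n) 𝓘(ℝ, Coord n) :=
  ⟨(contMDiffOn_of_mem_maximalAtlas hφ).mdifferentiableOn (by simp),
    (contMDiffOn_symm_of_mem_maximalAtlas hφ).mdifferentiableOn (by simp)⟩

lemma isInvertible_toCoord (hφ : φ ∈ smoothCharts n M) (hx : x ∈ φ.source) :
    (toCoord φ x).IsInvertible :=
  ⟨(mdifferentiable_of_mem_smoothCharts hφ).mfderiv hx, rfl⟩

lemma toCoord_ofCoord (hφ : φ ∈ smoothCharts n M) (hx : x ∈ φ.source) (v : Coord n) :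
    toCoord φ x (ofCoord φ x v) = v :=
  (isInvertible_toCoord hφ hx).self_apply_inverse v

lemma ofCoord_toCoord (hφ : φ ∈ smoothCharts n M) (hx : x ∈ φ.source) (v : Tan n x) :
    ofCoord φ x (toCoord φ x v) = v :=
  (isInvertible_toCoord hφ hx).inverse_apply_self v

lemma ofCoord_eq_sum (v : Coord n) : ofCoord φ x v = ∑ i, v i • partialVec φ x i := by
  conv_lhs => rw [← (EuclideanSpace.basisFun (Fin (n + 1)) ℝ).sum_repr v]
  simp only [map_sum, map_smul, EuclideanSpace.basisFun_repr, EuclideanSpace.basisFun_apply]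
  rfl

lemma map_ofCoord {F : Type*} [AddCommGroup F] [Module ℝ F] [TopologicalSpace F]
    (f : Tan n x →L[ℝ] F) (v : Coord n) :
    f (ofCoord φ x v) = ∑ i, v i • f (partialVec φ x i) := by
  simp only [ofCoord_eq_sum, map_sum, map_smul]

lemma apply_ofCoord (T : Tensor2 n M) (v w : Coord n) :
    T x (ofCoord φ x v) (ofCoord φ x w) = ∑ i, ∑ j, v i * (w j * comp2 T φ i j x) := by
  simp only [map_ofCoord, sum_apply, smul_apply, smul_eq_mul, Finset.mul_sum, comp2]

lemma tendsto_apply_ofCoord {α : Type*} {l : Filter α} {T : Tensor2 n M} {y : α → M}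
    {v w : α → Coord n} {v₀ w₀ : Coord n}
    (hT : ∀ i j, Tendsto (fun a => comp2 T φ i j (y a)) l (𝓝 (comp2 T φ i j x)))
    (hv : Tendsto v l (𝓝 v₀)) (hw : Tendsto w l (𝓝 w₀)) :
    Tendsto (fun a => T (y a) (ofCoord φ (y a) (v a)) (ofCoord φ (y a) (w a))) l
      (𝓝 (T x (ofCoord φ x v₀) (ofCoord φ x w₀))) := by
  simp only [apply_ofCoord]
  have hcoord (i : Fin (n + 1)) : Continuous fun z : Coord n => z i := by fun_prop
  exact tendsto_finsetSum _ fun i _ => tendsto_finsetSum _ fun j _ =>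
    (((hcoord i).tendsto _).comp hv).mul ((((hcoord j).tendsto _).comp hw).mul (hT i j))

lemma eq_of_forall_comp2_eq {T T' : Tensor2 n M} (hφ : φ ∈ smoothCharts n M) (hx : x ∈ φ.source)
    (h : ∀ i j, comp2 T φ i j x = comp2 T' φ i j x) : T x = T' x := by
  ext v w
  rw [← ofCoord_toCoord hφ hx v, ← ofCoord_toCoord hφ hx w, apply_ofCoord, apply_ofCoord]
  simp only [h]

lemma continuousAt_toCoord_field [IsManifold 𝓘(ℝ, Coord n) ∞ M] (hφ : φ ∈ smoothCharts n M)
    {X : VField n M} (hX : Continuous fun x => (⟨x, X x⟩ : TangentBundle 𝓘(ℝ, Coord n) M))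
    (hx : x ∈ φ.source) : ContinuousAt (fun y => toCoord φ y (X y)) x := by
  have htangent : ContinuousOn (fun y => tangentMapWithin 𝓘(ℝ, Coord n) 𝓘(ℝ, Coord n) φ φ.source
      (⟨y, X y⟩ : TangentBundle 𝓘(ℝ, Coord n) M)) φ.source :=
    ((contMDiffOn_of_mem_maximalAtlas hφ).continuousOn_tangentMapWithin (by simp)
      φ.open_source.uniqueMDiffOn).comp hX.continuousOn fun _ hy => hy
  have hsnd := continuous_snd.comp_continuousOn
    ((tangentBundleModelSpaceHomeomorph 𝓘(ℝ, Coord n)).continuous.comp_continuousOn htangent)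
  refine (hsnd.continuousAt (φ.open_source.mem_nhds hx)).congr ?_
  filter_upwards [φ.open_source.mem_nhds hx] with y hy
  simp only [Function.comp, tangentBundleModelSpaceHomeomorph, tangentMapWithin]
  rw [mfderivWithin_eq_mfderiv (φ.open_source.uniqueMDiffOn y hy)
    ((mdifferentiable_of_mem_smoothCharts hφ).mdifferentiableAt hy)]
  rfl

lemma hasDerivAt_chart_comp (hφ : φ ∈ smoothCharts n M) {γ : ℝ → M} {t : ℝ} {v : Tan n (γ t)}
    (hγ : HasMFDerivAt 𝓘(ℝ, ℝ) 𝓘(ℝ, Coord n) γ t ((1 : ℝ →L[ℝ] ℝ).smulRight v))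
    (ht : γ t ∈ φ.source) : HasDerivAt (φ ∘ γ) (toCoord φ (γ t) v) t := by
  have hcomp : HasFDerivAt (φ ∘ γ)
      ((toCoord φ (γ t)).comp ((1 : ℝ →L[ℝ] ℝ).smulRight v) : ℝ →L[ℝ] Coord n) t :=
    hasMFDerivAt_iff_hasFDerivAt.1
      (((mdifferentiable_of_mem_smoothCharts hφ).mdifferentiableAt ht).hasMFDerivAt.comp t hγ)
  exact hcomp.hasDerivAt.congr_deriv (congrArg (toCoord φ (γ t)) (one_smul ℝ v))

lemma toCoord_velocity (hφ : φ ∈ smoothCharts n M) {γ : ℝ → M} {t : ℝ}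
    (hγ : MDifferentiableAt 𝓘(ℝ, ℝ) 𝓘(ℝ, Coord n) γ t) (ht : γ t ∈ φ.source) :
    toCoord φ (γ t) (velocity n γ t) = deriv (φ ∘ γ) t := by
  have hvel : ((1 : ℝ →L[ℝ] ℝ).smulRight (velocity n γ t) : ℝ →L[ℝ] Tan n (γ t))
      = mfderiv 𝓘(ℝ, ℝ) 𝓘(ℝ, Coord n) γ t :=
    ContinuousLinearMap.ext_ring (one_smul ℝ (velocity n γ t))
  exact (hasDerivAt_chart_comp hφ (hvel ▸ hγ.hasMFDerivAt) ht).deriv.symm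

lemma velocity_segment (hφ : φ ∈ smoothCharts n M) {y v : Coord n} {c t : ℝ}
    (ht : y + (t - c) • v ∈ φ.target) :
    velocity n (fun t => φ.symm (y + (t - c) • v)) t
      = ofCoord φ (φ.symm (y + (t - c) • v)) v := by
  set σ : ℝ → M := fun t => φ.symm (y + (t - c) • v)
  have hline : HasDerivAt (fun t : ℝ => y + (t - c) • v) v t :=
    ((((hasDerivAt_id t).sub_const c).smul_const v).const_add y).congr_deriv (one_smul ℝ v)
  have hσ : MDifferentiableAt 𝓘(ℝ, ℝ) 𝓘(ℝ, Coord n) σ t :=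
    ((mdifferentiable_of_mem_smoothCharts hφ).mdifferentiableAt_symm ht).comp t
      hline.differentiableAt.mdifferentiableAt
  have hφσ : φ ∘ σ =ᶠ[𝓝 t] fun t => y + (t - c) • v := by
    filter_upwards [hline.continuousAt.preimage_mem_nhds (φ.open_target.mem_nhds ht)] with s hs
    exact φ.right_inv hs
  rw [← ofCoord_toCoord hφ (φ.map_target ht) (velocity n σ t),
    toCoord_velocity hφ hσ (φ.map_target ht), hφσ.deriv_eq, hline.deriv]

end Charts

section LipschitzCurves

variable {n : ℕ} {M : Type*} [TopologicalSpace M] [ChartedSpace (Coord n) M]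
  {φ : OpenPartialHomeomorph M (Coord n)} {γ γ' : ℝ → M} {a b c t : ℝ}

lemma LipschitzCurve.congr (h : LipschitzCurve n γ a b) (heq : EqOn γ' γ (Icc a b)) :
    LipschitzCurve n γ' a b := by
  refine ⟨h.1.congr heq, fun t ht => ?_⟩
  obtain ⟨φ, hφ, hγt, s, hs, K, hK⟩ := h.2 t ht
  refine ⟨φ, hφ, by rwa [heq ht], s ∩ Icc a b, inter_mem hs self_mem_nhdsWithin, K, ?_⟩
  exact lipschitzOnWith_congr (hK.mono inter_subset_left) fun τ hτ => congrArg φ (heq hτ.2)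

lemma LipschitzCurve.exists_lipschitzOnWith (h : LipschitzCurve n γ a b) (ht : t ∈ Icc a b)
    (hφ : φ ∈ smoothCharts n M) (hγt : γ t ∈ φ.source) :
    ∃ s ∈ 𝓝[Icc a b] t, ∃ K : NNReal, LipschitzOnWith K (φ ∘ γ) s := by
  obtain ⟨ψ, hψ, hγtψ, s, hs, K, hK⟩ := h.2 t ht
  have htransition : ContMDiffAt 𝓘(ℝ, Coord n) 𝓘(ℝ, Coord n) ∞ (φ ∘ ψ.symm) (ψ (γ t)) := by
    refine ContMDiffAt.comp _ (I' := 𝓘(ℝ, Coord n)) ?_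
      (contMDiffAt_symm_of_mem_maximalAtlas hψ (ψ.map_source hγtψ))
    rw [ψ.left_inv hγtψ]
    exact contMDiffAt_of_mem_maximalAtlas hφ hγt
  obtain ⟨K', V, hV, hK'⟩ := (htransition.contDiffAt.of_le (by simp)).exists_lipschitzOnWith
  set s' := s ∩ (γ ⁻¹' ψ.source ∩ (ψ ∘ γ) ⁻¹' V)
  have hs' : s' ∈ 𝓝[Icc a b] t := inter_mem hs (inter_mem
    ((h.1 t ht).preimage_mem_nhdsWithin (ψ.open_source.mem_nhds hγtψ))
    (((ψ.continuousAt hγtψ).comp_continuousWithinAt (h.1 t ht)).preimage_mem_nhdsWithin hV))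
  refine ⟨s', hs', K' * K, ?_⟩
  refine lipschitzOnWith_congr (hK'.comp (hK.mono (inter_subset_left (t := _ ∩ _)))
    fun τ hτ => hτ.2.2) fun τ hτ => ?_
  simp only [Function.comp, ψ.left_inv hτ.2.1]

lemma LipschitzCurve.eventually_norm_deriv_le (h : LipschitzCurve n γ a b) (hab : a < b)
    (hφ : φ ∈ smoothCharts n M) (hγa : γ a ∈ φ.source) :
    ∃ C : ℝ, ∀ᶠ t in 𝓝[>] a, ‖deriv (φ ∘ γ) t‖ ≤ C := by
  obtain ⟨s, hs, K, hK⟩ := h.exists_lipschitzOnWith (left_mem_Icc.2 hab.le) hφ hγa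
  have hs' : s ∈ 𝓝[>] a :=
    nhdsWithin_mono a Ioi_subset_Ici_self (nhdsWithin_Icc_eq_nhdsGE hab ▸ hs)
  refine ⟨K, ?_⟩
  filter_upwards [eventually_eventually_nhdsWithin.2 hs', self_mem_nhdsWithin] with t hst hat
  rw [isOpen_Ioi.nhdsWithin_eq hat] at hst
  exact norm_deriv_le_of_lipschitzOn hst hK

lemma LipschitzCurve.union (h : LipschitzCurve n γ a b) (h' : LipschitzCurve n γ b c)
    (hab : a ≤ b) (hbc : b ≤ c) : LipschitzCurve n γ a c := by
  have hIcc : Icc a c = Icc a b ∪ Icc b c := (Icc_union_Icc_eq_Icc hab hbc).symm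
  refine ⟨hIcc ▸ h.1.union_of_isClosed h'.1 isClosed_Icc isClosed_Icc, fun t ht => ?_⟩
  have hnhds : 𝓝[Icc a c] t = 𝓝[Icc a b] t ⊔ 𝓝[Icc b c] t := by rw [hIcc, nhdsWithin_union]
  rcases lt_trichotomy t b with htb | rfl | htb
  · obtain ⟨φ, hφ, hγt, s, hs, hK⟩ := h.2 t ⟨ht.1, htb.le⟩
    have hbot : 𝓝[Icc b c] t = ⊥ :=
      notMem_closure_iff_nhdsWithin_eq_bot.1 (by simp [isClosed_Icc.closure_eq, htb])
    exact ⟨φ, hφ, hγt, s, by rwa [hnhds, hbot, sup_bot_eq], hK⟩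
  · obtain ⟨φ, hφ, hγt, s, hs, K, hK⟩ := h.2 t (right_mem_Icc.2 hab)
    obtain ⟨s', hs', K', hK'⟩ := h'.exists_lipschitzOnWith (left_mem_Icc.2 hbc) hφ hγt
    refine ⟨φ, hφ, hγt, (s ∩ Icc a t) ∪ (s' ∩ Icc t c), ?_, max K K', ?_⟩
    · rw [hnhds]
      exact union_mem_sup (inter_mem hs self_mem_nhdsWithin) (inter_mem hs' self_mem_nhdsWithin)
    · exact lipschitzOnWith_union_of_le_of_ge
        ((hK.mono inter_subset_left).weaken (le_max_left _ _))
        ((hK'.mono inter_subset_left).weaken (le_max_right _ _))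
        ⟨mem_of_mem_nhdsWithin (right_mem_Icc.2 hab) hs, right_mem_Icc.2 hab⟩
        ⟨mem_of_mem_nhdsWithin (left_mem_Icc.2 hbc) hs', left_mem_Icc.2 hbc⟩
        (fun τ hτ => hτ.2.2) (fun τ hτ => hτ.2.1)
  · obtain ⟨φ, hφ, hγt, s, hs, hK⟩ := h'.2 t ⟨htb.le, ht.2⟩
    have hbot : 𝓝[Icc a b] t = ⊥ :=
      notMem_closure_iff_nhdsWithin_eq_bot.1 (by simp [isClosed_Icc.closure_eq, htb])
    exact ⟨φ, hφ, hγt, s, by rwa [hnhds, hbot, bot_sup_eq], hK⟩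

lemma velocity_eq_of_eventuallyEq (h : γ' =ᶠ[𝓝 t] γ) :
    (⟨γ' t, velocity n γ' t⟩ : TangentBundle 𝓘(ℝ, Coord n) M) = ⟨γ t, velocity n γ t⟩ :=
  Bundle.TotalSpace.ext h.eq_of_nhds
    (heq_of_eq (DFunLike.congr_fun (h.mfderiv_eq (I := 𝓘(ℝ, ℝ)) (I' := 𝓘(ℝ, Coord n))) 1))

end LipschitzCurves

section LorentzAlgebra

variable {n : ℕ} {M : Type*} [TopologicalSpace M] [ChartedSpace (Coord n) M]
  {φ : OpenPartialHomeomorph M (Coord n)} {x : M}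

/-- The matrix `T(∂ᵢ, ∂ⱼ)` of a 2-tensor at the point `x` in the chart `φ`; `coordMatrix` is the
same matrix as a function of the coordinates. -/
def compMatrix (T : Tensor2 n M) (φ : OpenPartialHomeomorph M (Coord n)) (x : M) :
    Matrix (Fin (n + 1)) (Fin (n + 1)) ℝ :=
  Matrix.of fun i j => comp2 T φ i j x

lemma coordMatrix_apply_chart (T : Tensor2 n M) (hx : x ∈ φ.source) :
    coordMatrix T φ (φ x) = compMatrix T φ x := by
  simp only [coordMatrix, compMatrix, φ.left_inv hx]

lemma apply_partialVec (T : Tensor2 n M) (hφ : φ ∈ smoothCharts n M) (hx : x ∈ φ.source)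
    (i : Fin (n + 1)) (v : Tan n x) :
    T x (partialVec φ x i) v = (compMatrix T φ x).mulVec (toCoord φ x v).ofLp i := by
  conv_lhs => rw [← ofCoord_toCoord hφ hx v, map_ofCoord]
  exact Finset.sum_congr rfl fun j _ => mul_comm _ _

variable [IsManifold 𝓘(ℝ, Coord n) ∞ M]

lemma chartAt_mem_smoothCharts (x : M) : chartAt (Coord n) x ∈ smoothCharts n M :=
  IsManifold.chart_mem_maximalAtlas (I := 𝓘(ℝ, Coord n)) x

lemma ricci_partialVec (g : Tensor2 n M) (x : M) (i j : Fin (n + 1)) :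
    ricci g x (partialVec (chartAt (Coord n) x) x i) (partialVec (chartAt (Coord n) x) x j)
      = ricciCoord (coordMatrix g (chartAt (Coord n) x)) i j (chartAt (Coord n) x x) := by
  have hdual (k l : Fin (n + 1)) : dcoord (chartAt (Coord n) x) x k
      (partialVec (chartAt (Coord n) x) x l) = if k = l then 1 else 0 := by
    have h := toCoord_ofCoord (chartAt_mem_smoothCharts x) (mem_chart_source (Coord n) x)
      (EuclideanSpace.single l 1)
    exact (congrArg (fun v : Coord n => v k) h).trans (by simp)
  simp [ricci, hdual]

namespace ContinuousSpacetime

variable (S : ContinuousSpacetime n M)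

lemma exists_basis_apply_eq (x : M) : ∃ b : Module.Basis (Fin (n + 1)) ℝ (Tan n x),
    ∀ v w : Tan n x, S.g x v w
      = -(b.repr v 0 * b.repr w 0) + ∑ i : Fin n, b.repr v i.succ * b.repr w i.succ := by
  obtain ⟨b, hb⟩ := S.lorentzian x
  refine ⟨b, fun v w => ?_⟩
  conv_lhs => rw [← b.sum_repr v, ← b.sum_repr w]
  simp only [map_sum, map_smul, sum_apply, smul_apply, hb]
  simp [Fin.sum_univ_succ, Fin.succ_ne_zero, mul_comm]

lemma eq_zero_of_forall_apply_eq_zero {v : Tan n x} (h : ∀ w, S.g x w v = 0) : v = 0 := by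
  obtain ⟨b, hb⟩ := S.exists_basis_apply_eq x
  refine b.ext_elem fun i => ?_
  have hi := h (b i)
  rw [hb] at hi
  refine Fin.cases (fun hi => ?_) (fun j hi => ?_) i hi <;>
    simpa [Finsupp.single_apply, Fin.succ_ne_zero, (Fin.succ_ne_zero _).symm] using hi

lemma apply_self_mul_apply_self_le_sq {v w : Tan n x} (hw : S.g x w w < 0) :
    S.g x v v * S.g x w w ≤ S.g x v w ^ 2 := by
  obtain ⟨b, hb⟩ := S.exists_basis_apply_eq x
  have spacelike (z : Tan n x) (hz : b.repr z 0 = 0) : 0 ≤ S.g x z z := by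
    rw [hb, hz, zero_mul, neg_zero, zero_add]
    exact Finset.sum_nonneg fun i _ => mul_self_nonneg _
  have hw0 : b.repr w 0 ≠ 0 := fun h => hw.not_ge (spacelike w h)
  have hcomb := spacelike (b.repr w 0 • v - b.repr v 0 • w) (by simp [mul_comm])
  simp only [map_sub, map_smul, sub_apply, smul_apply, smul_eq_mul, S.symm x w v] at hcomb
  have hsq := sq_nonneg (b.repr w 0 * S.g x v w - b.repr v 0 * S.g x w w)
  have hmul := mul_nonneg hcomb (neg_nonneg.2 hw.le)
  refine le_of_mul_le_mul_left ?_ (sq_pos_of_ne_zero hw0)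
  linarith

lemma isUnit_det_compMatrix (hφ : φ ∈ smoothCharts n M) (hx : x ∈ φ.source) :
    IsUnit (compMatrix S.g φ x).det := by
  refine isUnit_iff_ne_zero.2 fun hdet => ?_
  obtain ⟨z, hz, hGz⟩ := Matrix.exists_mulVec_eq_zero_iff.2 hdet
  have hzero : ofCoord φ x (WithLp.toLp 2 z) = 0 := by
    refine S.eq_zero_of_forall_apply_eq_zero fun w => ?_
    rw [S.symm, ← ofCoord_toCoord hφ hx w, map_ofCoord]
    refine Finset.sum_eq_zero fun i _ => ?_
    rw [S.symm, apply_partialVec S.g hφ hx, toCoord_ofCoord hφ hx, hGz, Pi.zero_apply,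
      smul_zero]
  have htoLp := toCoord_ofCoord hφ hx (WithLp.toLp 2 z)
  rw [hzero, map_zero] at htoLp
  exact hz (congrArg WithLp.ofLp htoLp).symm

lemma toCoord_eq_inv_mulVec (hφ : φ ∈ smoothCharts n M) (hx : x ∈ φ.source) (v : Tan n x) :
    toCoord φ x v = WithLp.toLp 2
      ((compMatrix S.g φ x)⁻¹.mulVec fun i => S.g x v (partialVec φ x i)) := by
  have hlower : (fun i => S.g x v (partialVec φ x i))
      = (compMatrix S.g φ x).mulVec (toCoord φ x v).ofLp :=
    funext fun i => (S.symm x _ _).trans (apply_partialVec S.g hφ hx i v)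
  rw [hlower, Matrix.mulVec_mulVec, Matrix.nonsing_inv_mul _ (S.isUnit_det_compMatrix hφ hx),
    Matrix.one_mulVec]

lemma sum_inv_mul_compMatrix (hφ : φ ∈ smoothCharts n M) (hx : x ∈ φ.source) :
    ∑ i, ∑ j, (compMatrix S.g φ x)⁻¹ i j * compMatrix S.g φ x i j = (n : ℝ) + 1 := by
  have htrace : ((compMatrix S.g φ x)⁻¹ * compMatrix S.g φ x).trace = (n : ℝ) + 1 := by
    simp [Matrix.nonsing_inv_mul _ (S.isUnit_det_compMatrix hφ hx)]
  rw [← htrace]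
  simp only [Matrix.trace, Matrix.diag_apply, Matrix.mul_apply]
  exact Finset.sum_congr rfl fun i _ => Finset.sum_congr rfl fun j _ =>
    congrArg _ (S.symm x _ _)

lemma sum_inv_mul_apply_mul_apply (hφ : φ ∈ smoothCharts n M) (hx : x ∈ φ.source) (v : Tan n x) :
    ∑ i, ∑ j, (compMatrix S.g φ x)⁻¹ i j *
      (S.g x v (partialVec φ x i) * S.g x v (partialVec φ x j)) = S.g x v v := by
  conv_rhs =>
    arg 2
    rw [← ofCoord_toCoord hφ hx v]
  rw [map_ofCoord]
  refine Finset.sum_congr rfl fun i _ => ?_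
  rw [S.toCoord_eq_inv_mulVec hφ hx v]
  simp only [Matrix.mulVec, dotProduct, smul_eq_mul, Finset.sum_mul]
  exact Finset.sum_congr rfl fun j _ => by ring

lemma scalarCurv_eq_of_ricci_eq {a b : ℝ} {U : Tan n x}
    (h : ∀ v w, ricci S.g x v w = a * S.g x v w + b * (S.g x U v * S.g x U w)) :
    scalarCurv S.g x = a * ((n : ℝ) + 1) + b * S.g x U U := by
  have hφ := chartAt_mem_smoothCharts (n := n) x
  have hx := mem_chart_source (Coord n) x
  rw [← S.sum_inv_mul_compMatrix hφ hx, ← S.sum_inv_mul_apply_mul_apply hφ hx, scalarCurv]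
  simp only [← ricci_partialVec, h, coordMatrix_apply_chart S.g hx, Finset.mul_sum,
    ← Finset.sum_add_distrib]
  refine Finset.sum_congr rfl fun i _ => Finset.sum_congr rfl fun j _ => ?_
  simp only [compMatrix, comp2, Matrix.of_apply]
  ring

variable {S} in
lemma SolvesEinsteinPerfectFluid.ricci_eq {N : Set M} {u : VField n M} {ρ p : M → ℝ}
    (h : S.SolvesEinsteinPerfectFluid N u ρ p) (hn : 2 ≤ n) (hx : x ∈ N) (v w : Tan n x) :
    ricci S.g x v w = 8 * Real.pi * (ρ x + p x) * (S.g x (u x) v * S.g x (u x) w)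
      + 8 * Real.pi * (ρ x - p x) / ((n : ℝ) - 1) * S.g x v w := by
  have htrace := S.scalarCurv_eq_of_ricci_eq (U := u x)
    (a := 1 / 2 * scalarCurv S.g x + 8 * Real.pi * p x) (b := 8 * Real.pi * (ρ x + p x))
    fun v w => by linear_combination h.einstein x hx v w
  rw [h.unit_u x hx] at htrace
  have hn1 : (n : ℝ) - 1 ≠ 0 := by
    have : (2 : ℝ) ≤ n := by exact_mod_cast hn
    linarith
  have hcoeff : 8 * Real.pi * (ρ x - p x) / ((n : ℝ) - 1)
      = 1 / 2 * scalarCurv S.g x + 8 * Real.pi * p x := by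
    rw [div_eq_iff hn1]
    linear_combination htrace
  rw [hcoeff]
  linear_combination h.einstein x hx v w

end ContinuousSpacetime

end LorentzAlgebra

section TimelikeCurves

namespace ContinuousSpacetime

variable {n : ℕ} {M : Type*} [TopologicalSpace M] [ChartedSpace (Coord n) M]
  [IsManifold 𝓘(ℝ, Coord n) ∞ M] {S : ContinuousSpacetime n M}
  {φ : OpenPartialHomeomorph M (Coord n)} {o x : M}

/-- `v` is future directed timelike with `g(v, v) < -ε`: the pointwise condition on the velocity of
a future directed timelike curve. -/
def FutureTimelikeBelow (S : ContinuousSpacetime n M) (ε : ℝ) {x : M} (v : Tan n x) : Prop :=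
  S.FutureTimelike v ∧ S.g x v v < -ε

lemma FutureTimelikeBelow.mono {ε ε' : ℝ} {v : Tan n x} (h : S.FutureTimelikeBelow ε v)
    (hε : ε' ≤ ε) : S.FutureTimelikeBelow ε' v :=
  ⟨h.1, h.2.trans_le (neg_le_neg hε)⟩

lemma FutureTimelikeBelow.velocity_congr {γ γ' : ℝ → M} {t ε : ℝ}
    (hγ : S.FutureTimelikeBelow ε (velocity n γ t)) (h : γ' =ᶠ[𝓝 t] γ) :
    S.FutureTimelikeBelow ε (velocity n γ' t) :=
  (congrArg (fun z : TangentBundle 𝓘(ℝ, Coord n) M => S.FutureTimelikeBelow ε z.2)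
    (velocity_eq_of_eventuallyEq h)).mpr hγ

lemma IsTimelikeCurve.concat {γ₁ γ₂ : ℝ → M} {a b c : ℝ} (h₁ : S.IsTimelikeCurve γ₁ a b)
    (h₂ : S.IsTimelikeCurve γ₂ b c) (hb : γ₁ b = γ₂ b) :
    S.IsTimelikeCurve (fun t => if t ≤ b then γ₁ t else γ₂ t) a c := by
  obtain ⟨hab, hlip₁, ε₁, hε₁, hv₁⟩ := h₁
  obtain ⟨hbc, hlip₂, ε₂, hε₂, hv₂⟩ := h₂
  set γ : ℝ → M := fun t => if t ≤ b then γ₁ t else γ₂ t with hγ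
  have hγ₁ : EqOn γ γ₁ (Iic b) := fun t ht => if_pos ht
  have hγ₂ : EqOn γ γ₂ (Ici b) := fun t ht => by
    rcases (mem_Ici.1 ht).eq_or_lt with rfl | hlt
    · simp only [hγ, le_refl, if_true, hb]
    · exact if_neg (not_le.2 hlt)
  refine ⟨hab.trans hbc, (hlip₁.congr (hγ₁.mono Icc_subset_Iic_self)).union
    (hlip₂.congr (hγ₂.mono Icc_subset_Ici_self)) hab.le hbc.le, min ε₁ ε₂, lt_min hε₁ hε₂, ?_⟩
  rw [ae_restrict_iff' measurableSet_Icc] at hv₁ hv₂ ⊢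
  filter_upwards [hv₁, hv₂, volume.ae_ne b] with t ht₁ ht₂ htb ht
  rcases lt_or_gt_of_ne htb with hlt | hlt
  · exact (FutureTimelikeBelow.mono (ht₁ ⟨ht.1, hlt.le⟩) (min_le_left _ _)).velocity_congr
      (hγ₁.eventuallyEq_of_mem (Iic_mem_nhds hlt))
  · exact (FutureTimelikeBelow.mono (ht₂ ⟨hlt.le, ht.2⟩) (min_le_right _ _)).velocity_congr
      (hγ₂.eventuallyEq_of_mem (Ici_mem_nhds hlt))

lemma isTimelikeCurve_segment (hφ : φ ∈ smoothCharts n M) {y v : Coord n} {ε s : ℝ} (c : ℝ)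
    (hs : 0 < s) (hε : 0 < ε) (htarget : ∀ t ∈ Icc 0 s, y + t • v ∈ φ.target)
    (hv : ∀ t ∈ Icc 0 s, S.FutureTimelikeBelow ε (ofCoord φ (φ.symm (y + t • v)) v)) :
    S.IsTimelikeCurve (fun t => φ.symm (y + (t - c) • v)) c (c + s) := by
  have hshift {t : ℝ} (ht : t ∈ Icc c (c + s)) : t - c ∈ Icc 0 s :=
    ⟨sub_nonneg.2 ht.1, sub_le_iff_le_add'.2 ht.2⟩
  have hline : Continuous fun t : ℝ => y + (t - c) • v := by fun_prop
  refine ⟨lt_add_of_pos_right c hs, ⟨φ.symm.continuousOn.comp hline.continuousOn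
    fun t ht => htarget _ (hshift ht), fun t ht => ⟨φ, hφ, φ.map_target (htarget _ (hshift ht)),
      Icc c (c + s), self_mem_nhdsWithin, ‖v‖₊, ?_⟩⟩, ε, hε, ?_⟩
  · have hlip : LipschitzWith ‖v‖₊ fun t : ℝ => y + (t - c) • v :=
      LipschitzWith.of_dist_le_mul fun t t' => by
        rw [dist_add_left, dist_eq_norm, ← sub_smul, sub_sub_sub_cancel_right, norm_smul,
          dist_eq_norm, mul_comm, coe_nnnorm]
    exact lipschitzOnWith_congr hlip.lipschitzOnWith fun t ht =>
      φ.right_inv (htarget _ (hshift ht))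
  · rw [ae_restrict_iff' measurableSet_Icc]
    refine Eventually.of_forall fun t ht => ?_
    rw [velocity_segment hφ (htarget _ (hshift ht))]
    exact hv _ (hshift ht)

lemma continuousAt_comp2 (S : ContinuousSpacetime n M) (hφ : φ ∈ smoothCharts n M)
    (hx : x ∈ φ.source) (i j : Fin (n + 1)) : ContinuousAt (comp2 S.g φ i j) x :=
  (S.continuous_metric φ hφ i j).continuousAt (φ.open_source.mem_nhds hx)

lemma FutureTimelike.exists_eventually_futureTimelikeBelow {U : Tan n o}
    (hU : S.FutureTimelike U) (hφ : φ ∈ smoothCharts n M) (ho : o ∈ φ.source) :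
    ∃ ε > 0, ∀ᶠ z : M × Coord n in 𝓝 o ×ˢ 𝓝 (toCoord φ o U),
      S.FutureTimelikeBelow ε (ofCoord φ z.1 z.2) := by
  obtain ⟨ε, hε, hUε⟩ : ∃ ε > 0, S.g o U U < -ε :=
    ⟨-S.g o U U / 2, by linarith [hU.1], by linarith [hU.1]⟩
  have hfst : Tendsto Prod.fst (𝓝 o ×ˢ 𝓝 (toCoord φ o U)) (𝓝 o) := tendsto_fst
  have hg (i j : Fin (n + 1)) := (S.continuousAt_comp2 hφ ho i j).tendsto.comp hfst
  have hX := (continuousAt_toCoord_field hφ S.continuous_X ho).tendsto.comp hfst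
  rw [← ofCoord_toCoord hφ ho U] at hUε
  refine ⟨ε, hε, ?_⟩
  filter_upwards [hfst.eventually_mem (φ.open_source.mem_nhds ho),
    (tendsto_apply_ofCoord hg tendsto_snd tendsto_snd).eventually_lt_const hUε,
    (tendsto_apply_ofCoord hg hX tendsto_snd).eventually_lt_const (by
      rw [ofCoord_toCoord hφ ho, ofCoord_toCoord hφ ho]
      exact hU.2)] with z hz hzε hzX
  refine ⟨⟨hzε.trans (by linarith), ?_⟩, hzε⟩
  rwa [Function.comp_apply, ofCoord_toCoord hφ hz] at hzX

end ContinuousSpacetime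

end TimelikeCurves

section FlowLines

namespace ContinuousSpacetime

variable {n : ℕ} {M : Type*} [TopologicalSpace M] [ChartedSpace (Coord n) M]
  [IsManifold 𝓘(ℝ, Coord n) ∞ M] {S : ContinuousSpacetime n M}
  {φ : OpenPartialHomeomorph M (Coord n)} {N : Set M} {u : VField n M} {o q : M}

/-- A flow line of the fluid starting at `o`: an integral curve `γ` of `u` in `N` on `(a, d)` which,
with the value `γ a = o`, is a future directed timelike curve on `[a, b]` for all `b` in
`(a, d)`. -/
structure IsFlowLineFrom (S : ContinuousSpacetime n M) (N : Set M) (u : VField n M) (o : M)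
    (γ : ℝ → M) (a d : ℝ) : Prop where
  mapsTo : MapsTo γ (Ioo a d) N
  isMIntegralCurveOn : IsMIntegralCurveOn (I := 𝓘(ℝ, Coord n)) γ u (Ioo a d)
  apply_left : γ a = o
  isTimelikeCurve : ∀ b ∈ Ioo a d, S.IsTimelikeCurve γ a b

lemma IntegralCurvesEmanateFrom.exists_isFlowLineFrom (h : S.IntegralCurvesEmanateFrom N u o)
    (hN : IsOpen N)
    (hu : ContMDiffOn 𝓘(ℝ, Coord n) 𝓘(ℝ, Coord n).tangent 1
      (fun x => (⟨x, u x⟩ : TangentBundle 𝓘(ℝ, Coord n) M)) N) (hq : q ∈ N) :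
    ∃ (γ : ℝ → M) (a d : ℝ), S.IsFlowLineFrom N u o γ a d ∧ ∃ t ∈ Ioo a d, γ t = q := by
  have : IsManifold 𝓘(ℝ, Coord n) 1 M := IsManifold.of_le (n := ∞) (by simp)
  obtain ⟨γ, hγ0, hγ⟩ := exists_isMIntegralCurveAt_of_contMDiffAt_boundaryless (t₀ := 0)
    (hu.contMDiffAt (hN.mem_nhds hq))
  have hmem : ∀ᶠ t in 𝓝 (0 : ℝ), γ t ∈ N :=
    hγ.continuousAt.eventually_mem (hN.mem_nhds (hγ0.symm ▸ hq))
  obtain ⟨ε, hε, hball⟩ := Metric.eventually_nhds_iff_ball.1 (hmem.and hγ)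
  rw [Real.ball_eq_Ioo, zero_sub, zero_add] at hball
  have h0 : (0 : ℝ) ∈ Ioo (-ε) ε := ⟨neg_lt_zero.2 hε, hε⟩
  obtain ⟨Γ, a, ha, hΓγ, hΓN, hΓu, hΓa, -, hΓ⟩ := h γ (-ε) ε (h0.1.trans h0.2)
    (fun t ht => (hball t ht).1) fun t ht => (hball t ht).2.hasMFDerivWithinAt
  exact ⟨Γ, a, ε, ⟨hΓN, hΓu, hΓa, hΓ⟩, 0, ⟨ha.trans_lt h0.1, hε⟩, (hΓγ h0).trans hγ0⟩

namespace IsFlowLineFrom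

variable {γ : ℝ → M} {a b d t : ℝ}

lemma continuousOn (h : S.IsFlowLineFrom N u o γ a d) (hb : b ∈ Ioo a d) :
    ContinuousOn γ (Icc a b) :=
  (h.isTimelikeCurve b hb).2.1.1

lemma tendsto_left (h : S.IsFlowLineFrom N u o γ a d) (had : a < d) :
    Tendsto γ (𝓝[>] a) (𝓝[N] o) := by
  obtain ⟨b, hb⟩ := exists_between had
  refine tendsto_nhdsWithin_iff.2 ⟨?_, ?_⟩
  · have hγa := h.continuousOn hb a (left_mem_Icc.2 hb.1.le)
    rw [ContinuousWithinAt, h.apply_left] at hγa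
    rw [← nhdsWithin_Ioo_eq_nhdsGT hb.1]
    exact hγa.mono_left (nhdsWithin_mono a Ioo_subset_Icc_self)
  · filter_upwards [Ioo_mem_nhdsGT had] with t ht using h.mapsTo ht

lemma hasDerivAt_chart (h : S.IsFlowLineFrom N u o γ a d) (hφ : φ ∈ smoothCharts n M)
    (ht : t ∈ Ioo a d) (hγt : γ t ∈ φ.source) :
    HasDerivAt (φ ∘ γ) (toCoord φ (γ t) (u (γ t))) t :=
  hasDerivAt_chart_comp hφ
    ((h.isMIntegralCurveOn t ht).hasMFDerivAt (Ioo_mem_nhds ht.1 ht.2)) hγt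

lemma eventually_norm_toCoord_le (h : S.IsFlowLineFrom N u o γ a d) (had : a < d)
    (hφ : φ ∈ smoothCharts n M) (ho : o ∈ φ.source) :
    ∃ C : ℝ, ∀ᶠ t in 𝓝[>] a, ‖toCoord φ (γ t) (u (γ t))‖ ≤ C := by
  obtain ⟨b, hb⟩ := exists_between had
  obtain ⟨C, hC⟩ := (h.isTimelikeCurve b hb).2.1.eventually_norm_deriv_le hb.1 hφ
    (h.apply_left ▸ ho)
  refine ⟨C, ?_⟩
  filter_upwards [hC, Ioo_mem_nhdsGT had, (h.tendsto_left had).eventually_mem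
    (mem_nhdsWithin_of_mem_nhds (φ.open_source.mem_nhds ho))] with t htC ht hγt
  rwa [(h.hasDerivAt_chart hφ ht hγt).deriv] at htC

end IsFlowLineFrom

end ContinuousSpacetime

end FlowLines

section FluidLimit

namespace ContinuousSpacetime

variable {n : ℕ} {M : Type*} [TopologicalSpace M] [ChartedSpace (Coord n) M]
  [IsManifold 𝓘(ℝ, Coord n) ∞ M] {S : ContinuousSpacetime n M}
  {φ : OpenPartialHomeomorph M (Coord n)} {o : M}

lemma tendsto_toCoord_of_tendsto_apply {l : Filter M} (hl : l ≤ 𝓝 o) (hφ : φ ∈ smoothCharts n M)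
    (ho : o ∈ φ.source) {u : VField n M} {y : Fin (n + 1) → ℝ}
    (hu : ∀ i, Tendsto (fun x => S.g x (u x) (partialVec φ x i)) l (𝓝 (y i))) :
    Tendsto (fun x => toCoord φ x (u x)) l
      (𝓝 (WithLp.toLp 2 ((compMatrix S.g φ o)⁻¹.mulVec y))) := by
  have hG : Tendsto (compMatrix S.g φ) l (𝓝 (compMatrix S.g φ o)) :=
    tendsto_pi_nhds.2 fun i => tendsto_pi_nhds.2 fun j =>
      (S.continuousAt_comp2 hφ ho i j).mono_left hl
  have hinv : Tendsto (fun x => (compMatrix S.g φ x)⁻¹) l (𝓝 (compMatrix S.g φ o)⁻¹) := by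
    refine (continuousAt_matrix_inv _ ?_).tendsto.comp hG
    rw [Ring.inverse_eq_inv']
    exact continuousAt_inv₀ (S.isUnit_det_compMatrix hφ ho).ne_zero
  have hmul : Tendsto (fun x => (compMatrix S.g φ x)⁻¹.mulVec
      fun i => S.g x (u x) (partialVec φ x i)) l (𝓝 ((compMatrix S.g φ o)⁻¹.mulVec y)) :=
    tendsto_pi_nhds.2 fun i => by
      simp only [Matrix.mulVec, dotProduct]
      exact tendsto_finsetSum _ fun j _ =>
        (tendsto_pi_nhds.1 (tendsto_pi_nhds.1 hinv i) j).mul (hu j)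
  refine (((PiLp.continuous_toLp 2 _).tendsto _).comp hmul).congr' ?_
  filter_upwards [hl (φ.open_source.mem_nhds ho)] with x hx
  exact (S.toCoord_eq_inv_mulVec hφ hx (u x)).symm

lemma tendsto_apply_of_tendsto_toCoord {l : Filter M} (hl : l ≤ 𝓝 o) (hφ : φ ∈ smoothCharts n M)
    (ho : o ∈ φ.source) {v w : VField n M} {V W : Tan n o}
    (hv : Tendsto (fun x => toCoord φ x (v x)) l (𝓝 (toCoord φ o V)))
    (hw : Tendsto (fun x => toCoord φ x (w x)) l (𝓝 (toCoord φ o W))) :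
    Tendsto (fun x => S.g x (v x) (w x)) l (𝓝 (S.g o V W)) := by
  have h := tendsto_apply_ofCoord
    (fun i j => (S.continuousAt_comp2 hφ ho i j).mono_left hl) hv hw
  rw [ofCoord_toCoord hφ ho, ofCoord_toCoord hφ ho] at h
  refine h.congr' ?_
  filter_upwards [hl (φ.open_source.mem_nhds ho)] with x hx
  rw [ofCoord_toCoord hφ hx, ofCoord_toCoord hφ hx]

lemma exists_eventually_apply_X_le_neg (S : ContinuousSpacetime n M) (o : M) :
    ∃ c > 0, ∀ᶠ x in 𝓝 o, ∀ v : Tan n x, S.FutureTimelike v → S.g x v v = -1 →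
      S.g x (S.X x) v ≤ -c := by
  have hX := continuousAt_toCoord_field (chartAt_mem_smoothCharts o) S.continuous_X
    (mem_chart_source (Coord n) o)
  have hXX := tendsto_apply_of_tendsto_toCoord (S := S) le_rfl (chartAt_mem_smoothCharts o)
    (mem_chart_source (Coord n) o) hX hX
  have hpos : 0 < -S.g o (S.X o) (S.X o) / 2 := by linarith [S.timelike_X o]
  refine ⟨√(-S.g o (S.X o) (S.X o) / 2), Real.sqrt_pos.2 hpos, ?_⟩
  filter_upwards [hXX.eventually_lt_const
    (show S.g o (S.X o) (S.X o) < S.g o (S.X o) (S.X o) / 2 by linarith)] with x hx v hv hunit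
  have hcs := S.apply_self_mul_apply_self_le_sq (v := S.X x) hv.1
  rw [hunit] at hcs
  refine le_neg_of_le_neg (Real.sqrt_le_iff.2 ⟨(neg_pos.2 hv.2).le, ?_⟩)
  linarith [neg_sq (S.g x (S.X x) v)]

lemma exists_tendsto_toCoord {l : Filter M} [l.NeBot] (hl : l ≤ 𝓝 o)
    (hφ : φ ∈ smoothCharts n M) (ho : o ∈ φ.source) {u : VField n M}
    (hfut : ∀ᶠ x in l, S.FutureTimelike (u x)) (hunit : ∀ᶠ x in l, S.g x (u x) (u x) = -1)
    {A : Fin (n + 1) → Fin (n + 1) → ℝ}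
    (hA : ∀ i j, Tendsto (fun x => S.g x (u x) (partialVec φ x i) * S.g x (u x) (partialVec φ x j))
      l (𝓝 (A i j))) :
    ∃ U : Tan n o, S.FutureTimelike U ∧
      Tendsto (fun x => toCoord φ x (u x)) l (𝓝 (toCoord φ o U)) := by
  have hX : Tendsto (fun x => toCoord φ x (S.X x)) l (𝓝 (toCoord φ o (S.X o))) :=
    (continuousAt_toCoord_field hφ S.continuous_X ho).mono_left hl
  have hXi (i : Fin (n + 1)) :
      Tendsto (fun x => toCoord φ x (S.X x) i) l (𝓝 (toCoord φ o (S.X o) i)) :=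
    ((EuclideanSpace.proj i : Coord n →L[ℝ] ℝ).continuous.tendsto _).comp hX
  obtain ⟨c, hc, hXc⟩ := S.exists_eventually_apply_X_le_neg o
  have hXu : ∀ᶠ x in l, S.g x (S.X x) (u x) ≤ -c := by
    filter_upwards [hl hXc, hfut, hunit] with x hx using hx (u x)
  have hsum : ∀ᶠ x in l, ∑ i, toCoord φ x (S.X x) i * S.g x (u x) (partialVec φ x i) ≤ -c := by
    filter_upwards [hXu, hl (φ.open_source.mem_nhds ho)] with x hxc hx
    rwa [S.symm, ← ofCoord_toCoord hφ hx (S.X x), map_ofCoord] at hxc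
  choose y hy using exists_tendsto_of_tendsto_mul hA hXi hc hsum
  have hu := tendsto_toCoord_of_tendsto_apply hl hφ ho hy
  rw [← toCoord_ofCoord hφ ho (WithLp.toLp 2 _)] at hu
  refine ⟨_, ⟨?_, ?_⟩, hu⟩
  · have huu := tendsto_nhds_unique (tendsto_apply_of_tendsto_toCoord hl hφ ho hu hu)
      (tendsto_const_nhds.congr' (hunit.mono fun x hx => hx.symm))
    exact huu.trans_lt neg_one_lt_zero
  · exact (le_of_tendsto (tendsto_apply_of_tendsto_toCoord hl hφ ho hX hu) hXu).trans_lt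
      (neg_lt_zero.2 hc)

end ContinuousSpacetime

end FluidLimit

section ChronologyViolation

namespace ContinuousSpacetime

variable {n : ℕ} {M : Type*} [TopologicalSpace M] [ChartedSpace (Coord n) M]
  [IsManifold 𝓘(ℝ, Coord n) ∞ M] {S : ContinuousSpacetime n M}
  {φ : OpenPartialHomeomorph M (Coord n)} {N : Set M} {u : VField n M} {o : M}

/-- At every point of the closed coordinate ball of radius `r` about `y₀`, all coordinate directions
at distance less than `η` from `w` are future directed timelike, uniformly so: within this ball,
straight coordinate segments in these directions are future directed timelike curves. -/
structure IsTimelikeBall (S : ContinuousSpacetime n M) (φ : OpenPartialHomeomorph M (Coord n))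
    (y₀ : Coord n) (r : ℝ) (w : Coord n) (η : ℝ) : Prop where
  subset_target : Metric.closedBall y₀ r ⊆ φ.target
  exists_futureTimelikeBelow : ∃ ε > 0, ∀ y ∈ Metric.closedBall y₀ r, ∀ v, ‖v - w‖ < η →
    S.FutureTimelikeBelow ε (ofCoord φ (φ.symm y) v)

lemma FutureTimelike.exists_eventually_isTimelikeBall {U : Tan n o} (hU : S.FutureTimelike U)
    (hφ : φ ∈ smoothCharts n M) (ho : o ∈ φ.source) :
    ∃ η > 0, ∀ᶠ r in 𝓝[>] (0 : ℝ), S.IsTimelikeBall φ (φ o) r (toCoord φ o U) η := by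
  obtain ⟨ε, hε, h⟩ := hU.exists_eventually_futureTimelikeBelow hφ ho
  obtain ⟨P, hP, Q, hQ, hPQ⟩ := eventually_prod_iff.1 h
  obtain ⟨η, hη, hball⟩ := Metric.eventually_nhds_iff_ball.1 hQ
  refine ⟨η, hη, ?_⟩
  filter_upwards [eventually_forall_mem_closedBall_symm ho hP] with r hr
  exact ⟨fun y hy => (hr y hy).1, ε, hε, fun y hy v hv =>
    hPQ (hr y hy).2 (hball v (mem_ball_iff_norm.2 hv))⟩

namespace IsTimelikeBall

variable {y₀ w y z : Coord n} {r η s : ℝ}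

lemma mono {η' : ℝ} (h : S.IsTimelikeBall φ y₀ r w η) (hη : η' ≤ η) :
    S.IsTimelikeBall φ y₀ r w η' := by
  obtain ⟨ε, hε, hball⟩ := h.exists_futureTimelikeBelow
  exact ⟨h.subset_target, ε, hε, fun y hy v hv => hball y hy v (hv.trans_le hη)⟩

lemma isTimelikeCurve_segment (h : S.IsTimelikeBall φ y₀ r w η) (hφ : φ ∈ smoothCharts n M)
    (c : ℝ) (hs : 0 < s) (hy : y ∈ Metric.closedBall y₀ r) (hz : z ∈ Metric.closedBall y₀ r)
    (hw : ‖s⁻¹ • (z - y) - w‖ < η) :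
    S.IsTimelikeCurve (fun t => φ.symm (y + (t - c) • s⁻¹ • (z - y))) c (c + s) := by
  obtain ⟨ε, hε, hball⟩ := h.exists_futureTimelikeBelow
  have hsegment (t : ℝ) (ht : t ∈ Icc 0 s) :
      y + t • s⁻¹ • (z - y) ∈ Metric.closedBall y₀ r := by
    rw [smul_smul]
    exact (convex_closedBall y₀ r).add_smul_sub_mem hy hz
      ⟨mul_nonneg ht.1 (inv_nonneg.2 hs.le), mul_inv_le_one_of_le₀ ht.2 hs.le⟩
  exact ContinuousSpacetime.isTimelikeCurve_segment hφ c hs hε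
    (fun t ht => h.subset_target (hsegment t ht)) fun t ht => hball _ (hsegment t ht) _ hw

lemma symm_mem_timelikeFuture (h : S.IsTimelikeBall φ y₀ r w η) (hφ : φ ∈ smoothCharts n M)
    (hs : 0 < s) (hy : y ∈ Metric.closedBall y₀ r) (hz : z ∈ Metric.closedBall y₀ r)
    (hw : ‖s⁻¹ • (z - y) - w‖ < η) : φ.symm z ∈ S.timelikeFuture (φ.symm y) univ := by
  refine ⟨_, 0, 0 + s, h.isTimelikeCurve_segment hφ 0 hs hy hz hw, mapsTo_univ _ _, ?_, ?_⟩
  · rw [sub_self, zero_smul, add_zero]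
  · rw [add_sub_cancel_left, smul_inv_smul₀ hs.ne', add_sub_cancel]

lemma symm_mem_timelikeFuture_of_isTimelikeCurve (h : S.IsTimelikeBall φ y₀ r w η)
    (hφ : φ ∈ smoothCharts n M) {γ : ℝ → M} {a b : ℝ} (hγ : S.IsTimelikeCurve γ a b)
    (hγb : γ b = φ.symm y) (hs : 0 < s) (hy : y ∈ Metric.closedBall y₀ r)
    (hz : z ∈ Metric.closedBall y₀ r) (hw : ‖s⁻¹ • (z - y) - w‖ < η) :
    φ.symm z ∈ S.timelikeFuture (γ a) univ := by
  refine ⟨_, a, b + s, hγ.concat (h.isTimelikeCurve_segment hφ b hs hy hz hw) ?_,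
    mapsTo_univ _ _, if_pos hγ.1.le, ?_⟩
  · rw [sub_self, zero_smul, add_zero, hγb]
  · rw [if_neg (lt_add_of_pos_right b hs).not_ge, add_sub_cancel_left, smul_inv_smul₀ hs.ne',
      add_sub_cancel]

end IsTimelikeBall

lemma IsFlowLineFrom.exists_norm_sub_sub_smul_le [T2Space M] {γ : ℝ → M} {a d t₀ : ℝ}
    {y₀ z w : Coord n} {r η : ℝ} (h : S.IsFlowLineFrom N u o γ a d) (hφ : φ ∈ smoothCharts n M)
    (hr : Metric.closedBall y₀ r ⊆ φ.target)
    (hη : ∀ y ∈ Metric.closedBall y₀ r, φ.symm y ∈ N →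
      ‖toCoord φ (φ.symm y) (u (φ.symm y)) - w‖ ≤ η)
    (ht₀ : t₀ ∈ Ioo a d) (hz : z ∈ Metric.closedBall y₀ r) (hγz : γ t₀ = φ.symm z) :
    ∃ t ∈ Icc a t₀, ∃ y ∈ Metric.closedBall y₀ r, γ t = φ.symm y ∧ (t = a ∨ r ≤ ‖y - y₀‖) ∧
      ‖z - y - (t₀ - t) • w‖ ≤ η * (t₀ - t) := by
  have hK : IsClosed (φ.symm '' Metric.closedBall y₀ r) :=
    ((isCompact_closedBall y₀ r).image_of_continuousOn (φ.continuousOn_symm.mono hr)).isClosed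
  obtain ⟨t, ht, htK, hexit⟩ := exists_mapsTo_Icc_right (h.continuousOn ht₀) hK ht₀.1.le
    ⟨z, hz, hγz.symm⟩
  have hsource : ∀ τ ∈ Icc t t₀, γ τ ∈ φ.source := fun τ hτ => by
    obtain ⟨y, hy, hyτ⟩ := htK hτ
    exact hyτ ▸ φ.map_target (hr hy)
  have hdrift := norm_sub_sub_smul_le_of_hasDerivAt (f := φ ∘ γ) (w := w) (η := η) ht.2
    (φ.continuousOn.comp ((h.continuousOn ht₀).mono (Icc_subset_Icc_left ht.1)) hsource)
    (fun τ hτ => h.hasDerivAt_chart hφ ⟨ht.1.trans_lt hτ.1, hτ.2.trans ht₀.2⟩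
      (hsource τ (Ioo_subset_Icc_self hτ))) fun τ hτ => by
      obtain ⟨y, hy, hyτ⟩ := htK (Ioo_subset_Icc_self hτ)
      rw [← hyτ]
      exact hη y hy (hyτ ▸ h.mapsTo ⟨ht.1.trans_lt hτ.1, hτ.2.trans ht₀.2⟩)
  obtain ⟨y, hy, hyt⟩ := htK (left_mem_Icc.2 ht.2)
  refine ⟨t, ht, y, hy, hyt.symm, hexit.imp_right fun hint => ?_, ?_⟩
  · by_contra! hlt
    have hopen : IsOpen (φ.symm '' Metric.ball y₀ r) := φ.symm.isOpen_image_of_subset_source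
      Metric.isOpen_ball (Metric.ball_subset_closedBall.trans hr)
    exact hint (interior_maximal (image_mono Metric.ball_subset_closedBall) hopen
      ⟨y, mem_ball_iff_norm.2 hlt, hyt⟩)
  · rwa [Function.comp_apply, Function.comp_apply, hγz, ← hyt, φ.right_inv (hr hz),
      φ.right_inv (hr hy)] at hdrift

lemma IsFlowLineFrom.mem_timelikeFuture [T2Space M] {γ : ℝ → M} {a d t₀ : ℝ} {z w : Coord n}
    {r η : ℝ} (h : S.IsFlowLineFrom N u o γ a d) (hφ : φ ∈ smoothCharts n M) (ho : o ∈ φ.source)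
    (hball : S.IsTimelikeBall φ (φ o) r w (2 * η)) (hη : 0 < η) (hr : 0 < r)
    (hu : ∀ y ∈ Metric.closedBall (φ o) r, φ.symm y ∈ N →
      ‖toCoord φ (φ.symm y) (u (φ.symm y)) - w‖ ≤ η)
    (ht₀ : t₀ ∈ Ioo a d) (hz : z ∈ Metric.closedBall (φ o) r) (hγz : γ t₀ = φ.symm z)
    (hzr : ‖z - φ o‖ * (‖w‖ + 2 * η) < η * r)
    (hmiss : ∀ s > 0, η * s < ‖z - φ o - s • w‖) : o ∈ S.timelikeFuture o univ := by
  obtain ⟨t, ht, y, hy, hγt, hexit, hdrift⟩ :=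
    h.exists_norm_sub_sub_smul_le hφ hball.subset_target hu ht₀ hz hγz
  have hta : t ≠ a := by
    rintro rfl
    have hyo : y = φ o := by
      rw [← h.apply_left, hγt, φ.right_inv (hball.subset_target hy)]
    rw [hyo] at hdrift
    exact hdrift.not_gt (hmiss _ (sub_pos.2 ht₀.1))
  have hat : t ∈ Ioo a d := ⟨ht.1.lt_of_ne' hta, ht.2.trans_lt ht₀.2⟩
  obtain ⟨hs, hw⟩ := norm_inv_smul_neg_sub_lt hη (sub_nonneg.2 ht.2) (hexit.resolve_left hta)
    (by rwa [sub_sub_sub_cancel_right]) hzr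
  rw [neg_sub] at hw
  have hmem := hball.symm_mem_timelikeFuture_of_isTimelikeCurve hφ (h.isTimelikeCurve t hat) hγt hs
    hy (Metric.mem_closedBall_self hr.le) hw
  rwa [h.apply_left, φ.left_inv ho] at hmem

lemma FutureTimelike.toCoord_ne_zero {U : Tan n o} (hU : S.FutureTimelike U)
    (hφ : φ ∈ smoothCharts n M) (ho : o ∈ φ.source) : toCoord φ o U ≠ 0 := by
  intro hzero
  have hU0 := congrArg (ofCoord φ o) hzero
  rw [ofCoord_toCoord hφ ho, map_zero] at hU0
  exact hU.1.ne (by rw [hU0, map_zero])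

lemma IntegralCurvesEmanateFrom.mem_of_tendsto [T2Space M] (hn : 1 ≤ n)
    (h : S.IntegralCurvesEmanateFrom N u o) (hN : IsOpen N) (hoN : S.timelikeFuture o univ ⊆ N)
    (hu : ContMDiffOn 𝓘(ℝ, Coord n) 𝓘(ℝ, Coord n).tangent 1
      (fun x => (⟨x, u x⟩ : TangentBundle 𝓘(ℝ, Coord n) M)) N)
    (hφ : φ ∈ smoothCharts n M) (ho : o ∈ φ.source) {U : Tan n o} (hU : S.FutureTimelike U)
    (hlim : Tendsto (fun x => toCoord φ x (u x)) (𝓝[N] o) (𝓝 (toCoord φ o U))) : o ∈ N := by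
  set w := toCoord φ o U
  obtain ⟨η₀, hη₀, hball⟩ := hU.exists_eventually_isTimelikeBall hφ ho
  have hspan : Submodule.span ℝ {w} ≠ ⊤ :=
    span_singleton_ne_top (by rw [finrank_euclideanSpace_fin]; lia) w
  obtain ⟨v, hvw, hv⟩ :=
    exists_norm_sub_lt_notMem_span_singleton (hU.toCoord_ne_zero hφ ho) hspan hη₀
  obtain ⟨c, hc, hvc⟩ := exists_pos_mul_le_norm_smul_sub_smul hv
  obtain ⟨η, hη, hηmin⟩ := exists_between (lt_min hc (half_pos hη₀))
  obtain ⟨hηc, hηη₀⟩ := lt_min_iff.1 hηmin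
  have hnear : ∀ᶠ x in 𝓝 o, x ∈ N → ‖toCoord φ x (u x) - w‖ ≤ η := by
    filter_upwards [eventually_nhdsWithin_iff.1 (hlim.eventually_mem
      (Metric.closedBall_mem_nhds w hη))] with x hx hxN using mem_closedBall_iff_norm.1 (hx hxN)
  obtain ⟨r, ⟨hr, hu'⟩, hr0⟩ := ((hball.and (eventually_forall_mem_closedBall_symm ho hnear)).and
    self_mem_nhdsWithin).exists
  obtain ⟨τ, hτ, hzr⟩ := exists_pos_norm_smul_mul_lt v (‖w‖ + 2 * η) (mul_pos hη hr0)
  have hz : φ o + τ • v ∈ Metric.closedBall (φ o) r := by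
    rw [mem_closedBall_iff_norm, add_sub_cancel_left]
    nlinarith [norm_nonneg (τ • v), norm_nonneg w]
  have hzN : φ.symm (φ o + τ • v) ∈ N := by
    have hmem := hr.symm_mem_timelikeFuture hφ hτ (Metric.mem_closedBall_self hr0.le) hz
      (by rwa [add_sub_cancel_left, inv_smul_smul₀ hτ.ne'])
    rw [φ.left_inv ho] at hmem
    exact hoN hmem
  obtain ⟨γ, a, d, hγ, t₀, ht₀, hγz⟩ := h.exists_isFlowLineFrom hN hu hzN
  refine hoN (hγ.mem_timelikeFuture hφ ho (hr.mono (by linarith)) hη hr0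
    (fun y hy => (hu' y hy).2) ht₀ hz hγz (by rwa [add_sub_cancel_left]) fun s hs => ?_)
  rw [add_sub_cancel_left]
  exact (mul_lt_mul_of_pos_right hηc hs).trans_le (hvc τ s hs)

end ContinuousSpacetime

end ChronologyViolation

section Extension

variable {n : ℕ} {M : Type*} [TopologicalSpace M] [ChartedSpace (Coord n) M]
  {φ : OpenPartialHomeomorph M (Coord n)} {N : Set M} {o : M}

lemma IsContExtFun.tendsto {X : Type*} [TopologicalSpace X] {N : Set X} {o : X} {f f' : X → ℝ}
    (h : IsContExtFun N o f f') : Tendsto f (𝓝[N] o) (𝓝 (f' o)) := by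
  refine ((h.2 o (mem_insert o N)).mono_left (nhdsWithin_mono o (subset_insert o N))).congr' ?_
  filter_upwards [self_mem_nhdsWithin] with x hx using h.1 hx

lemma IsContExtTensor.exists_tendsto_comp2 {T T' : Tensor2 n M} (h : IsContExtTensor N o T T') :
    ∃ φ ∈ smoothCharts n M, o ∈ φ.source ∧
      ∀ i j, Tendsto (comp2 T φ i j) (𝓝[N] o) (𝓝 (comp2 T' φ i j o)) := by
  obtain ⟨hT, φ, hφ, ho, hcont⟩ := h
  refine ⟨φ, hφ, ho, fun i j => ?_⟩
  have hlim := hcont i j o ⟨ho, mem_insert o N⟩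
  rw [ContinuousWithinAt,
    nhdsWithin_inter_of_mem (nhdsWithin_le_nhds (φ.open_source.mem_nhds ho))] at hlim
  refine (hlim.mono_left (nhdsWithin_mono o (subset_insert o N))).congr' ?_
  filter_upwards [self_mem_nhdsWithin] with x hx
  rw [comp2, hT x hx, comp2]

namespace ContinuousSpacetime

variable [IsManifold 𝓘(ℝ, Coord n) ∞ M] {S : ContinuousSpacetime n M} {u : VField n M}
  {ρ p : M → ℝ}

lemma SolvesEinsteinPerfectFluid.tendsto_density_add_pressure_mul
    (h : S.SolvesEinsteinPerfectFluid N u ρ p) (hn : 2 ≤ n) (hφ : φ ∈ smoothCharts n M)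
    (ho : o ∈ φ.source) {i j : Fin (n + 1)} {R ρ₀ p₀ : ℝ}
    (hRic : Tendsto (comp2 (ricci S.g) φ i j) (𝓝[N] o) (𝓝 R))
    (hρ : Tendsto ρ (𝓝[N] o) (𝓝 ρ₀)) (hp : Tendsto p (𝓝[N] o) (𝓝 p₀)) :
    Tendsto (fun x => 8 * Real.pi * (ρ x + p x) *
        (S.g x (u x) (partialVec φ x i) * S.g x (u x) (partialVec φ x j))) (𝓝[N] o)
      (𝓝 (R - 8 * Real.pi * (ρ₀ - p₀) / ((n : ℝ) - 1) * comp2 S.g φ i j o)) := by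
  have hg := (S.continuousAt_comp2 hφ ho i j).mono_left (nhdsWithin_le_nhds (s := N))
  refine (hRic.sub ((((hρ.sub hp).const_mul _).div_const _).mul hg)).congr' ?_
  filter_upwards [self_mem_nhdsWithin] with x hx
  rw [comp2, h.ricci_eq hn hx, comp2, add_sub_cancel_right]

lemma SolvesEinsteinPerfectFluid.density_add_pressure_eq_zero [T2Space M]
    (h : S.SolvesEinsteinPerfectFluid N u ρ p) (hn : 1 ≤ n) (hN : IsOpen N)
    (ho : o ∈ closure N \ N) (hoN : S.timelikeFuture o univ ⊆ N)
    (hu : S.IntegralCurvesEmanateFrom N u o) (hφ : φ ∈ smoothCharts n M) (hoφ : o ∈ φ.source)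
    {c : ℝ} {A : Fin (n + 1) → Fin (n + 1) → ℝ}
    (hc : Tendsto (fun x => 8 * Real.pi * (ρ x + p x)) (𝓝[N] o) (𝓝 c))
    (hA : ∀ i j, Tendsto (fun x => 8 * Real.pi * (ρ x + p x) *
      (S.g x (u x) (partialVec φ x i) * S.g x (u x) (partialVec φ x j))) (𝓝[N] o) (𝓝 (A i j))) :
    c = 0 := by
  by_contra hne
  have : (𝓝[N] o).NeBot := mem_closure_iff_nhdsWithin_neBot.1 ho.1
  have hlim (i j : Fin (n + 1)) : Tendsto
      (fun x => S.g x (u x) (partialVec φ x i) * S.g x (u x) (partialVec φ x j)) (𝓝[N] o)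
      (𝓝 (A i j / c)) := by
    refine ((hA i j).div hc hne).congr' ?_
    filter_upwards [hc.eventually_ne hne] with x hx using mul_div_cancel_left₀ _ hx
  obtain ⟨U, hU, hUlim⟩ := exists_tendsto_toCoord (l := 𝓝[N] o) nhdsWithin_le_nhds hφ hoφ
    (eventually_mem_nhdsWithin.mono h.future_u) (eventually_mem_nhdsWithin.mono h.unit_u) hlim
  exact ho.2 (hu.mem_of_tendsto hn hN hoN (h.smooth_u.of_le (by simp)) hφ hoφ hU hUlim)

lemma IsFlowLineFrom.isBigO_apply_partialVec {γ : ℝ → M} {a d : ℝ}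
    (h : S.IsFlowLineFrom N u o γ a d) (had : a < d) (hφ : φ ∈ smoothCharts n M)
    (ho : o ∈ φ.source) (i : Fin (n + 1)) :
    (fun t => S.g (γ t) (u (γ t)) (partialVec φ (γ t) i)) =O[𝓝[>] a] fun _ => (1 : ℝ) := by
  have hγ : Tendsto γ (𝓝[>] a) (𝓝 o) := (h.tendsto_left had).mono_right nhdsWithin_le_nhds
  obtain ⟨C, hC⟩ := h.eventually_norm_toCoord_le had hφ ho
  have hcoord (j : Fin (n + 1)) :
      (fun t => toCoord φ (γ t) (u (γ t)) j) =O[𝓝[>] a] fun _ => (1 : ℝ) := by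
    refine Asymptotics.IsBigO.of_bound C (hC.mono fun t ht => ?_)
    rw [norm_one, mul_one]
    exact (PiLp.norm_apply_le _ j).trans ht
  have hterm (j : Fin (n + 1)) : (fun t => comp2 S.g φ i j (γ t) * toCoord φ (γ t) (u (γ t)) j)
      =O[𝓝[>] a] fun _ => (1 : ℝ) := by
    have hmul := (((S.continuousAt_comp2 hφ ho i j).tendsto.comp hγ).isBigO_one ℝ).mul (hcoord j)
    rwa [one_mul] at hmul
  refine (Asymptotics.IsBigO.fun_sum (s := Finset.univ) fun j _ => hterm j).congr' ?_
    EventuallyEq.rfl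
  filter_upwards [hγ.eventually_mem (φ.open_source.mem_nhds ho)] with t ht
  rw [S.symm, apply_partialVec S.g hφ ht]
  rfl

lemma IsFlowLineFrom.tendsto_mul_apply_partialVec_zero {γ : ℝ → M} {a d : ℝ} {f : M → ℝ}
    (h : S.IsFlowLineFrom N u o γ a d) (had : a < d) (hφ : φ ∈ smoothCharts n M)
    (ho : o ∈ φ.source) (hf : Tendsto f (𝓝[N] o) (𝓝 0)) (i j : Fin (n + 1)) :
    Tendsto (fun t => f (γ t) * (S.g (γ t) (u (γ t)) (partialVec φ (γ t) i) *
      S.g (γ t) (u (γ t)) (partialVec φ (γ t) j))) (𝓝[>] a) (𝓝 0) := by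
  have hfγ : (f ∘ γ) =o[𝓝[>] a] fun _ => (1 : ℝ) :=
    (Asymptotics.isLittleO_one_iff ℝ).2 (hf.comp (h.tendsto_left had))
  have hmul := hfγ.mul_isBigO
    ((h.isBigO_apply_partialVec had hφ ho i).mul (h.isBigO_apply_partialVec had hφ ho j))
  simp only [mul_one] at hmul
  exact (Asymptotics.isLittleO_one_iff ℝ).1 hmul

end ContinuousSpacetime

end Extension

end Cosmo

end

theorem corollary2p5_general {n : ℕ} (hn : 2 ≤ n) {Mext : Type*} [TopologicalSpace Mext]
    [T2Space Mext] [ChartedSpace (Cosmo.Coord n) Mext] [IsManifold 𝓘(ℝ, Cosmo.Coord n) ∞ Mext]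
    (S : Cosmo.ContinuousSpacetime n Mext) (M : Set Mext) (o : Mext)
    (hext : S.IsContinuousExtensionOf M) (ho : o ∈ closure M \ M)
    (hM : S.timelikeFuture o univ ⊆ M)
    (u : Cosmo.VField n Mext) (ρ p : Mext → ℝ) (ha : S.SolvesEinsteinPerfectFluid M u ρ p)
    (hb : S.IntegralCurvesEmanateFrom M u o)
    (ρ' p' : Mext → ℝ) (Ric' : Cosmo.Tensor2 n Mext)
    (hc_Ric : Cosmo.IsContExtTensor M o (Cosmo.ricci S.g) Ric')
    (hc_ρ : Cosmo.IsContExtFun M o ρ ρ') (hc_p : Cosmo.IsContExtFun M o p p')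
    (v w : Cosmo.Tan n o) :
    Ric' o v w = 16 * Real.pi * ρ' o / ((n : ℝ) - 1) * S.g o v w := by
  obtain ⟨φ, hφ, hoφ, hRic⟩ := hc_Ric.exists_tendsto_comp2
  have hfluid (i j : Fin (n + 1)) :=
    ha.tendsto_density_add_pressure_mul hn hφ hoφ (hRic i j) hc_ρ.tendsto hc_p.tendsto
  have hsum := (hc_ρ.tendsto.add hc_p.tendsto).const_mul (8 * Real.pi)
  have hzero := ha.density_add_pressure_eq_zero (by lia) hext.isOpen ho hM hb hφ hoφ hsum hfluid
  have hp' : p' o = -ρ' o :=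
    eq_neg_of_add_eq_zero_right ((mul_eq_zero_iff_left (by positivity)).1 hzero)
  obtain ⟨q, hq⟩ := closure_nonempty_iff.1 ⟨o, ho.1⟩
  obtain ⟨γ, a, d, hγ, t, ht, -⟩ :=
    hb.exists_isFlowLineFrom hext.isOpen (ha.smooth_u.of_le (by simp)) hq
  have had := ht.1.trans ht.2
  have hcomp (i j : Fin (n + 1)) : Cosmo.comp2 Ric' φ i j o
      = Cosmo.comp2 (fun x => (16 * Real.pi * ρ' o / ((n : ℝ) - 1)) • S.g x) φ i j o := by
    have hlim := tendsto_nhds_unique ((hfluid i j).comp (hγ.tendsto_left had))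
      (hγ.tendsto_mul_apply_partialVec_zero had hφ hoφ (hzero ▸ hsum) i j)
    rw [sub_eq_zero.1 hlim, hp', Cosmo.comp2, Cosmo.comp2, smul_apply, smul_apply, smul_eq_mul]
    ring
  rw [Cosmo.eq_of_forall_comp2_eq hφ hoφ hcomp, smul_apply, smul_apply, smul_eq_mul]

theorem corollary2p5 {n : ℕ} (hn : 2 ≤ n) {Mext : Type*} [TopologicalSpace Mext] [T2Space Mext]
    [SecondCountableTopology Mext] [ChartedSpace (Cosmo.Coord n) Mext]
    [IsManifold 𝓘(ℝ, Cosmo.Coord n) ∞ Mext]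
    (S : Cosmo.ContinuousSpacetime n Mext) (M : Set Mext) (o : Mext)
    (hext : S.IsContinuousExtensionOf M)
    (ho : o ∈ S.pastBoundary M)
    (hM : M = S.timelikeFuture o Set.univ)
    (u : Cosmo.VField n Mext) (ρ p : Mext → ℝ)
    (ha : S.SolvesEinsteinPerfectFluid M u ρ p)
    (hb : S.IntegralCurvesEmanateFrom M u o)
    (ρ' p' : Mext → ℝ) (Ric' : Cosmo.Tensor2 n Mext)
    (hc_Ric : Cosmo.IsContExtTensor M o (Cosmo.ricci S.g) Ric')
    (hc_ρ : Cosmo.IsContExtFun M o ρ ρ')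
    (hc_p : Cosmo.IsContExtFun M o p p')
    (hd : S.StronglyCausalAt o ∨ S.PastBoundaryLocallyInFuture M o) :
    ∀ v w : Cosmo.Tan n o,
      Ric' o v w = 16 * Real.pi * ρ' o / ((n : ℝ) - 1) * S.g o v w :=
  corollary2p5_general hn S M o hext ho.1 hM.ge u ρ p ha hb ρ' p' Ric' hc_Ric hc_ρ hc_p
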